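/- **Setting.** Let $V$ be a Euclidean space, $R_0\subset V$ an irreducible reduced crystallographic root system of full rank $n\ge 1$, with Weyl group $W_0$, simple roots $\alpha_1,\dots,\alpha_n$, and weight lattice $P=\{\lambda\in V:\langle\lambda,\alpha^\vee\rangle\in\mathbb Z\ \forall\alpha\in R_0\}$, where $\alpha^\vee=2\alpha/\langle\alpha,\alpha\rangle$. Let $c>0$, and choose one of two types, untwisted or twisted. In the untwisted case let $\theta$ be the highest root and $m_\alpha=1$ for all $\alpha\in R_0$; in the twisted case let $\theta$ be the highest short root and $m_\alpha=\langle\alpha,\alpha\rangle/\langle\theta,\theta\rangle$ (all roots count as short if $R_0$ is simply laced). Identify $v+r$ ($v\in V$, $r\in\mathbb R$) with the function $x\mapsto\langle v,x\rangle+r$ on $V$, and consider the irreducible reduced affine root system $$R=\{\alpha+m_\alpha r c:\ \alpha\in R_0,\ r\in\mathbb Z\}$$ with basis $a_0=\alpha_0+c$, $\alpha_0=-\theta$, and $a_j=\alpha_j$ for $1\le j\le n$. Let $\hat P=\{\lambda\in V:\langle\lambda,\alpha\rangle\in m_\alpha\mathbb Z\ \forall\alpha\in R_0\}$ be the weight lattice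 of the root system $\{m_\alpha\alpha^\vee:\alpha\in R_0\}$, and let $W=W_0\ltimes t(c\hat P)$ be the extended affine Weyl group of the transformations $vt_{c\lambda}$ of $V$ ($v\in W_0$, $\lambda\in\hat P$), where $t_y(x)=x+y$. Put $(vt_{c\lambda})'=v$. The group $W$ acts on functions by $(wf)(x)=f(w^{-1}x)$. It contains the reflections $s_j(x)=x-a_j(x)\alpha_j^\vee$ ($0\le j\le n$). Let $\Omega\subset W$ be the subgroup of the elements $u$ that permute $a_0,\dots,a_n$, and write $ua_j=a_{u_j}$. Let $m_{jk}\in\{1,2,\dots\}\cup\{\infty\}$ be the order of $s_js_k$. Let $\mathbb L$ be the algebra of complex Laurent polynomials in indeterminates $\tau_\alpha$ ($\alpha\in R_0$) subject to $\tau_{w\alpha}=\tau_\alpha$ for $w\in W_0$, and put $\tau_j=\tau_{\alpha_j}$ ($0\le j\le n$). The **double affine Hecke algebra at critical level** $\mathcal H$ is the unital associative $\mathbb L$-algebra with invertible generators $T_u$ ($u\in\Omega$), $T_j$ ($0\le j\le n$), $X^\lambda$ ($\lambda\in P$) and the following relations, for all $u,\tilde u\in\Omega$, $0\le j,k\le n$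 and $\lambda,\tilde\lambda\in P$: - $T_uT_{\tilde u}=T_{u\tilde u}$ and $T_uT_j=T_{u_j}T_u$; - $(T_j-\tau_j)(T_j+\tau_j^{-1})=0$; - $T_jT_kT_j\cdots=T_kT_jT_k\cdots$ ($m_{jk}$ factors on each side) if $j\ne k$ and $m_{jk}<\infty$; - $T_uX^\lambda=X^{u'\lambda}T_u$; - $T_jX^\lambda=X^{s_j'\lambda}T_j+(\tau_j-\tau_j^{-1})\dfrac{X^\lambda-X^{s_j'\lambda}}{1-X^{-\alpha_j}}$, where the quotient is computed in the group algebra $\mathbb L[P]$; - $X^\lambda X^{\tilde\lambda}=X^{\lambda+\tilde\lambda}$ and $X^0=1$. Let $\mathcal A$ be the localization of the group algebra $\mathbb L[P]$ (with basis $X^\lambda$, $\lambda\in P$) at the Weyl denominator $\prod_{\alpha\in R_0}(1-X^\alpha)$. Let $W_0$ act on $\mathcal A$ by the $\mathbb L$-algebra automorphisms $f\mapsto f^w$ with $(X^\lambda)^w=X^{w\lambda}$. The smash product $\mathcal A\,\#\,W$ is the $\mathbb L$-algebra of the finite formal sums $\sum_{w\in W}f_ww$ ($f_w\in\mathcal A$),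 with the multiplication determined by $(fv)(gw)=f\,g^{v'}\,vw$ for $f,g\in\mathcal A$ and $v,w\in W$. For $0\le j\le n$ put $$\check T_j=\tau_js_j+\frac{\tau_j-\tau_j^{-1}}{1-X^{-\alpha_j}}\,(1-s_j)\in\mathcal A\,\#\,W.$$ **Theorem (the basic representation of $\mathcal H$).** The assignments $T_j\mapsto\check T_j$ ($0\le j\le n$), $T_u\mapsto u$ ($u\in\Omega$) and $X^\lambda\mapsto X^\lambda$ ($\lambda\in P$) extend uniquely to a homomorphism $\mathcal H\to\mathcal A\,\#\,W$ of $\mathbb L$-algebras, and this homomorphism is injective. -/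

import Mathlib

open scoped RealInnerProductSpace

noncomputable section

namespace CriticalDAHA

/-- The weight lattice in `V` of a set `S` of (nonzero) vectors of a Euclidean space: the vectors
`l` with `⟨l, β^∨⟩ ∈ ℤ` for all `β ∈ S`, where `β^∨ = 2 β / ⟨β, β⟩`. -/
def weightLattice {V : Type*} [NormedAddCommGroup V] [InnerProductSpace ℝ V] (S : Set V) :
    AddSubgroup V where
  carrier := {l | ∀ β ∈ S, ∃ k : ℤ, ⟪l, (2 / ⟪β, β⟫) • β⟫ = k}
  zero_mem' := fun β _ => ⟨0, by simp⟩
  add_mem' := by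
    intro x y hx hy β hβ
    obtain ⟨k, hk⟩ := hx β hβ
    obtain ⟨l, hl⟩ := hy β hβ
    exact ⟨k + l, by rw [inner_add_left, hk, hl]; push_cast; rfl⟩
  neg_mem' := by
    intro x hx β hβ
    obtain ⟨k, hk⟩ := hx β hβ
    exact ⟨-k, by rw [inner_neg_left, hk]; push_cast; rfl⟩

/-- The alternating product `x y x ⋯` with `m` factors. -/
def altProd {M : Type*} [Monoid M] (x y : M) : ℕ → M
  | 0 => 1
  | m + 1 => x * altProd y x m

/-- The two ways of extending a finite root system to an affine one (they agree for simply laced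
root systems). -/
inductive AffineType
  | untwisted
  | twisted

/-- The data fixing an irreducible reduced affine root system with reduced gradient root system
`R₀`, in a Euclidean space `V`, together with a basis of it: an irreducible reduced crystallographic
root system `R₀` of full rank in `V`, with simple roots, a type (untwisted or twisted), a number
`c > 0`, and the highest root (if untwisted) or the highest short root (if twisted). -/
structure AffineRootData (ι V : Type*) [Fintype ι]
    [NormedAddCommGroup V] [InnerProductSpace ℝ V] where
  /-- The root system `R₀`, with roots and coroots in `V`. -/
  R₀ : RootPairing ι ℝ V V
  toLinearMap_eq : R₀.toLinearMap = innerₗ V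
  coroot_eq : ∀ i, R₀.coroot i = (2 / ⟪R₀.root i, R₀.root i⟫) • R₀.root i
  isRootSystem : R₀.IsRootSystem
  isCrystallographic : R₀.IsCrystallographic
  isReduced : R₀.IsReduced
  isIrreducible : R₀.IsIrreducible
  /-- The simple roots `α₁, …, αₙ`. -/
  base : R₀.Base
  /-- Whether the affine root system is untwisted or twisted. -/
  type : AffineType
  c : ℝ
  c_pos : 0 < c
  /-- The root `θ = -α₀`: the highest root if untwisted, the highest short root if twisted. -/
  θ : ι
  θ_highest : match type with
    | .untwisted => ∀ i, R₀.root θ - R₀.root i ∈ AddSubmonoid.closure (R₀.root '' base.support)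
    | .twisted =>
        (∀ i, ⟪R₀.root θ, R₀.root θ⟫ ≤ ⟪R₀.root i, R₀.root i⟫) ∧
        ∀ i, ⟪R₀.root i, R₀.root i⟫ = ⟪R₀.root θ, R₀.root θ⟫ →
          R₀.root θ - R₀.root i ∈ AddSubmonoid.closure (R₀.root '' base.support)

namespace AffineRootData

variable {ι V : Type*} [Fintype ι] [NormedAddCommGroup V] [InnerProductSpace ℝ V]
  (D : AffineRootData ι V)

/-! ### The affine root system -/

/-- The affine-linear function `x ↦ ⟨v, x⟩ + r` on `V`. -/
def affineFn (v : V) (r : ℝ) : V →ᵃ[ℝ] ℝ :=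
  (innerₗ V v).toAffineMap + AffineMap.const ℝ V r

@[simp] lemma affineFn_apply (v : V) (r : ℝ) (x : V) : affineFn v r x = ⟪v, x⟫ + r := rfl

/-- The integers `m_α`: all equal to `1` in the untwisted case; in the twisted case `1` for short
`α` and the squared ratio of the lengths of long and short roots for long `α`. -/
def m (i : ι) : ℝ :=
  match D.type with
  | .untwisted => 1
  | .twisted => ⟪D.R₀.root i, D.R₀.root i⟫ / ⟪D.R₀.root D.θ, D.R₀.root D.θ⟫

/-- The affine root system `R = {α + m_α r c | α ∈ R₀, r ∈ ℤ}`. -/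
def affineRoots : Set (V →ᵃ[ℝ] ℝ) :=
  {a | ∃ (i : ι) (r : ℤ), a = affineFn (D.R₀.root i) (D.m i * r * D.c)}

/-- The index set `{0, 1, …, n}` of the simple affine roots; `none` stands for `0`. -/
abbrev I : Type _ := Option D.base.support

/-- The gradient `α_j ∈ R₀` of the simple affine root `a_j`, where `α₀ = -θ`. -/
def gradIdx : D.I → ι
  | none => D.R₀.reflectionPerm D.θ D.θ
  | some j => j.1

/-- The vector `α_j`. -/
def α (j : D.I) : V := D.R₀.root (D.gradIdx j)

/-- The constant term of `a_j`. -/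
def const : D.I → ℝ
  | none => D.c
  | some _ => 0

/-- The simple affine roots `a₀ = α₀ + c` and `a_j = α_j`, `j = 1, …, n`. -/
def a (j : D.I) : V →ᵃ[ℝ] ℝ := affineFn (D.α j) (D.const j)

lemma α_zero : D.α none = -D.R₀.root D.θ := by
  simp [α, gradIdx]

lemma pairing_eq (i j : ι) : D.R₀.pairing i j = ⟪D.R₀.root i, D.R₀.coroot j⟫ := by
  rw [← RootPairing.root_coroot_eq_pairing, D.toLinearMap_eq]; rfl

lemma root_inner_pos (i : ι) : 0 < ⟪D.R₀.root i, D.R₀.root i⟫ :=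
  real_inner_self_pos.2 (D.R₀.ne_zero i)

lemma exists_int (i j : ι) :
    ∃ k : ℤ, ⟪D.R₀.root i, (2 / ⟪D.R₀.root j, D.R₀.root j⟫) • D.R₀.root j⟫ = k := by
  have := D.isCrystallographic
  obtain ⟨k, hk⟩ := D.R₀.exists_value (S := ℤ) i j
  refine ⟨k, ?_⟩
  rw [← D.coroot_eq, ← D.pairing_eq, ← hk]; simp

lemma m_pos (i : ι) : 0 < D.m i := by
  unfold m
  split
  · exact one_pos
  · exact div_pos (D.root_inner_pos _) (D.root_inner_pos _)

lemma m_gradIdx_zero : D.m (D.gradIdx none) = 1 := by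
  unfold m
  split
  · rfl
  · simp [gradIdx, D.R₀.ne_zero D.θ]

/-- The simple affine roots belong to the affine root system. -/
lemma a_mem (j : D.I) : D.a j ∈ D.affineRoots := by
  cases j with
  | none => exact ⟨D.gradIdx none, 1, by simp [a, α, const, D.m_gradIdx_zero]⟩
  | some j => exact ⟨j.1, 0, by simp [a, α, const, gradIdx]⟩

/-! ### Weyl groups -/

/-- The Weyl group `W₀` of `R₀`. -/
def W₀ : Subgroup (V ≃ₗ[ℝ] V) := Subgroup.closure (Set.range D.R₀.reflection)

/-- The weight lattice `P` of `R₀`. -/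
def P : AddSubgroup V := weightLattice (Set.range D.R₀.root)

/-- The root system `{m_α α^∨ | α ∈ R₀}`. -/
def hatR₀ : Set V := Set.range fun i => D.m i • D.R₀.coroot i

/-- The weight lattice `P̂` of `{m_α α^∨ | α ∈ R₀}`. -/
def hatP : AddSubgroup V := weightLattice D.hatR₀

lemma reflection_eq (i : ι) (x : V) :
    D.R₀.reflection i x = x - ⟪x, D.R₀.coroot i⟫ • D.R₀.root i := by
  rw [RootPairing.reflection_apply]
  simp [RootPairing.coroot', D.toLinearMap_eq, real_inner_comm]

lemma W₀_inner {v : V ≃ₗ[ℝ] V} (hv : v ∈ D.W₀) : ∀ x y, ⟪v x, v y⟫ = ⟪x, y⟫ := by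
  induction hv using Subgroup.closure_induction with
  | mem v hv =>
    obtain ⟨i, rfl⟩ := hv
    intro x y
    have h := (D.root_inner_pos i).ne'
    simp only [reflection_eq, D.coroot_eq, inner_sub_left, inner_sub_right, real_inner_smul_left,
      real_inner_smul_right, real_inner_comm (D.R₀.root i)]
    field_simp
    ring
  | one => intro x y; rfl
  | mul v w _ _ h1 h2 => intro x y; exact (h1 _ _).trans (h2 _ _)
  | inv v _ h =>
    intro x y
    rw [← h (v⁻¹ x) (v⁻¹ y), ← LinearEquiv.mul_apply, ← LinearEquiv.mul_apply, mul_inv_cancel]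
    rfl

lemma W₀_root {v : V ≃ₗ[ℝ] V} (hv : v ∈ D.W₀) : ∀ i, ∃ j, v (D.R₀.root i) = D.R₀.root j := by
  have key : ∀ i, (∃ j, v (D.R₀.root i) = D.R₀.root j) ∧ ∃ j, v⁻¹ (D.R₀.root i) = D.R₀.root j := by
    induction hv using Subgroup.closure_induction with
    | mem v hv =>
      obtain ⟨k, rfl⟩ := hv
      intro i
      exact ⟨⟨_, (D.R₀.root_reflectionPerm k i).symm⟩, ⟨_, by
        rw [RootPairing.reflection_inv]; exact (D.R₀.root_reflectionPerm k i).symm⟩⟩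
    | one => intro i; exact ⟨⟨i, rfl⟩, ⟨i, by simp⟩⟩
    | mul v w _ _ h1 h2 =>
      intro i
      obtain ⟨j, hj⟩ := (h2 i).1
      obtain ⟨k, hk⟩ := (h1 j).1
      obtain ⟨j', hj'⟩ := (h1 i).2
      obtain ⟨k', hk'⟩ := (h2 j').2
      refine ⟨⟨k, ?_⟩, ⟨k', ?_⟩⟩
      · rw [LinearEquiv.mul_apply, hj, hk]
      · rw [mul_inv_rev, LinearEquiv.mul_apply, hj', hk']
    | inv v _ h => intro i; exact ⟨(h i).2, by rw [inv_inv]; exact (h i).1⟩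
  exact fun i => (key i).1

lemma weightLattice_map {S : Set V} {v : V ≃ₗ[ℝ] V} (hv : v ∈ D.W₀)
    (hS : ∀ β ∈ S, v⁻¹ β ∈ S) {l : V} (hl : l ∈ weightLattice S) : v l ∈ weightLattice S := by
  intro β hβ
  obtain ⟨k, hk⟩ := hl _ (hS β hβ)
  refine ⟨k, ?_⟩
  have hv' := D.W₀_inner (D.W₀.inv_mem hv)
  rw [hv'] at hk
  rw [← hk, ← hv' (v l)]
  congr 1
  · rw [← LinearEquiv.mul_apply, inv_mul_cancel]; rfl
  · rw [map_smul]

lemma W₀_P {v : V ≃ₗ[ℝ] V} (hv : v ∈ D.W₀) {l : V} (hl : l ∈ D.P) : v l ∈ D.P := by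
  refine D.weightLattice_map hv ?_ hl
  rintro _ ⟨i, rfl⟩
  obtain ⟨j, hj⟩ := D.W₀_root (D.W₀.inv_mem hv) i
  exact ⟨j, hj.symm⟩

lemma W₀_hatP {v : V ≃ₗ[ℝ] V} (hv : v ∈ D.W₀) {l : V} (hl : l ∈ D.hatP) : v l ∈ D.hatP := by
  refine D.weightLattice_map hv ?_ hl
  rintro _ ⟨i, rfl⟩
  have hv' := D.W₀.inv_mem hv
  obtain ⟨j, hj⟩ := D.W₀_root hv' i
  have hij : ⟪D.R₀.root j, D.R₀.root j⟫ = ⟪D.R₀.root i, D.R₀.root i⟫ := by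
    rw [← hj, D.W₀_inner hv']
  refine ⟨j, ?_⟩
  have hm : D.m j = D.m i := by unfold m; rw [hij]
  simp only [hm, map_smul, D.coroot_eq, hij, hj]

/-- The translation `t_y : x ↦ x + y` of `V`. -/
def t (y : V) : V ≃ᵃ[ℝ] V := AffineEquiv.constVAdd ℝ V y

@[simp] lemma t_apply (y x : V) : t y x = x + y := add_comm _ _

/-- The extended affine Weyl group `W = W₀ ⋉ t(c P̂)`, as a group of affine transformations of `V`:
it consists of the maps `v t_{c l}` with `v ∈ W₀` and `l ∈ P̂`. -/
def W : Subgroup (V ≃ᵃ[ℝ] V) where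
  carrier := {w | ∃ v ∈ D.W₀, ∃ l ∈ D.hatP, w = v.toAffineEquiv * t (D.c • l)}
  one_mem' := ⟨1, one_mem _, 0, zero_mem _, by ext x; simp⟩
  mul_mem' := by
    rintro _ _ ⟨v, hv, l, hl, rfl⟩ ⟨v', hv', l', hl', rfl⟩
    refine ⟨v * v', mul_mem hv hv', v'⁻¹ l + l',
      add_mem (D.W₀_hatP (D.W₀.inv_mem hv') hl) hl', ?_⟩
    ext x
    simp
    abel
  inv_mem' := by
    rintro _ ⟨v, hv, l, hl, rfl⟩
    refine ⟨v⁻¹, D.W₀.inv_mem hv, -(v l), neg_mem (D.W₀_hatP hv hl), ?_⟩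
    rw [inv_eq_iff_mul_eq_one]
    ext x
    simp

/-- The action `(w f)(x) = f (w⁻¹ x)` on affine functions. -/
def actFn (w : V ≃ᵃ[ℝ] V) (f : V →ᵃ[ℝ] ℝ) : V →ᵃ[ℝ] ℝ := f.comp (w⁻¹ : V ≃ᵃ[ℝ] V).toAffineMap

lemma actFn_one (f : V →ᵃ[ℝ] ℝ) : actFn 1 f = f := by ext; simp [actFn]

lemma actFn_mul (w w' : V ≃ᵃ[ℝ] V) (f : V →ᵃ[ℝ] ℝ) :
    actFn (w * w') f = actFn w (actFn w' f) := by
  ext x; simp [actFn, mul_inv_rev]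

/-- The subgroup `Ω` of the elements of `W` that permute the simple affine roots. -/
def Ω : Subgroup D.W where
  carrier := {u | ∃ σ : Equiv.Perm D.I, ∀ j, actFn (u : V ≃ᵃ[ℝ] V) (D.a j) = D.a (σ j)}
  one_mem' := ⟨1, fun j => by simp [actFn_one]⟩
  mul_mem' := by
    rintro u u' ⟨σ, hσ⟩ ⟨σ', hσ'⟩
    exact ⟨σ * σ', fun j => by rw [Subgroup.coe_mul, actFn_mul, hσ', hσ]; rfl⟩
  inv_mem' := by
    rintro u ⟨σ, hσ⟩
    refine ⟨σ.symm, fun j => ?_⟩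
    have h := hσ (σ.symm j)
    rw [Equiv.apply_symm_apply] at h
    rw [← h, ← actFn_mul, Subgroup.coe_inv, inv_mul_cancel, actFn_one]

/-- The affine reflection `s_a : x ↦ x - a(x) α^∨` for `a = α + r`, where `α` is a root. -/
def affineReflection (i : ι) (r : ℝ) : V ≃ᵃ[ℝ] V :=
  (D.R₀.reflection i).toAffineEquiv * t (r • D.R₀.coroot i)

lemma affineReflection_apply (i : ι) (r : ℝ) (x : V) :
    D.affineReflection i r x = x - affineFn (D.R₀.root i) r x • D.R₀.coroot i := by
  have h := (D.root_inner_pos i).ne'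
  simp only [affineReflection, AffineEquiv.coe_mul, Function.comp, t_apply,
    LinearEquiv.coe_toAffineEquiv, D.reflection_eq, affineFn_apply, D.coroot_eq, inner_add_left,
    real_inner_smul_left, real_inner_smul_right, real_inner_comm x, smul_smul]
  rw [add_sub_assoc, ← sub_smul, sub_eq_add_neg x, ← neg_smul]
  congr 2
  field_simp
  ring

lemma coroot_θ_mem : D.R₀.coroot D.θ ∈ D.hatP := by
  rintro _ ⟨j, rfl⟩
  have h0 := (D.root_inner_pos D.θ).ne'
  have hj := (D.root_inner_pos j).ne'
  dsimp only
  cases ht : D.type with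
  | untwisted =>
    have hm : D.m j = 1 := by unfold m; rw [ht]
    obtain ⟨k, hk⟩ := D.exists_int j D.θ
    refine ⟨k, ?_⟩
    rw [← hk, hm, one_smul, D.coroot_eq, D.coroot_eq]
    simp only [real_inner_smul_left, real_inner_smul_right, real_inner_comm (D.R₀.root D.θ)]
    field_simp
  | twisted =>
    have hm : D.m j = ⟪D.R₀.root j, D.R₀.root j⟫ / ⟪D.R₀.root D.θ, D.R₀.root D.θ⟫ := by
      unfold m; rw [ht]
    obtain ⟨k, hk⟩ := D.exists_int D.θ j
    refine ⟨k, ?_⟩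
    rw [← hk, hm, D.coroot_eq, D.coroot_eq]
    simp only [real_inner_smul_left, real_inner_smul_right]
    field_simp

/-- The simple reflections `s_j = s_{a_j}`, `j = 0, …, n`, as elements of `W`. -/
def s (j : D.I) : D.W :=
  ⟨D.affineReflection (D.gradIdx j) (D.const j), by
    cases j with
    | none =>
      refine ⟨_, Subgroup.subset_closure ⟨D.gradIdx none, rfl⟩, -D.R₀.coroot D.θ,
        neg_mem D.coroot_θ_mem, ?_⟩
      simp [affineReflection, const, gradIdx]
    | some j =>
      refine ⟨_, Subgroup.subset_closure ⟨j.1, rfl⟩, 0, zero_mem _, ?_⟩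
      simp [affineReflection, const, gradIdx]⟩

/-- The linear part `w'` of `w ∈ W`, that is `(v t_{c l})' = v`, acting on the weight lattice. -/
def lin (w : D.W) : D.P →+ D.P where
  toFun l := ⟨(w : V ≃ᵃ[ℝ] V).linear l, by
    obtain ⟨_, v, hv, k, _, rfl⟩ := w
    exact D.W₀_P hv l.2⟩
  map_zero' := by ext; simp
  map_add' l l' := by ext; simp

@[simp] lemma coe_lin (w : D.W) (l : D.P) : (D.lin w l : V) = (w : V ≃ᵃ[ℝ] V).linear l := rfl

lemma lin_one : D.lin 1 = AddMonoidHom.id _ := by ext; simp; rfl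

lemma lin_mul (w w' : D.W) : D.lin (w * w') = (D.lin w).comp (D.lin w') := by ext; simp; rfl

/-- The roots lie in the weight lattice. -/
def rootP (i : ι) : D.P := ⟨D.R₀.root i, by rintro _ ⟨j, rfl⟩; exact D.exists_int i j⟩

/-- `α_j` as an element of the weight lattice. -/
def αP (j : D.I) : D.P := D.rootP (D.gradIdx j)

/-! ### The ground ring `𝕃`, the group algebra `𝕃[P]`, its localization `𝒜` and `𝒜 # W` -/

/-- Two roots are equivalent if they lie in the same `W₀`-orbit. -/
def orbitRel : Setoid ι where
  r i j := ∃ v ∈ D.W₀, v (D.R₀.root i) = D.R₀.root j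
  iseqv :=
    { refl := fun i => ⟨1, one_mem _, rfl⟩
      symm := by
        rintro i j ⟨v, hv, h⟩
        refine ⟨v⁻¹, D.W₀.inv_mem hv, ?_⟩
        rw [← h, ← LinearEquiv.mul_apply, inv_mul_cancel]; rfl
      trans := by
        rintro i j k ⟨v, hv, h⟩ ⟨v', hv', h'⟩
        exact ⟨v' * v, mul_mem hv' hv, by rw [LinearEquiv.mul_apply, h, h']⟩ }

/-- The algebra `𝕃` of complex Laurent polynomials in the indeterminates `τ_α`, `α ∈ R₀`, where
`τ_{wα} = τ_α` for `w ∈ W₀`: there is one indeterminate for each `W₀`-orbit of roots. -/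
abbrev 𝕃 : Type _ := AddMonoidAlgebra ℂ (Quotient D.orbitRel →₀ ℤ)

/-- The indeterminate `τ_α`, a unit of `𝕃`. -/
def τ (i : ι) : D.𝕃ˣ where
  val := AddMonoidAlgebra.single (Finsupp.single (Quotient.mk D.orbitRel i) 1) 1
  inv := AddMonoidAlgebra.single (Finsupp.single (Quotient.mk D.orbitRel i) (-1)) 1
  val_inv := by
    rw [AddMonoidAlgebra.single_mul_single, ← Finsupp.single_add]; simp
    rfl
  inv_val := by
    rw [AddMonoidAlgebra.single_mul_single, ← Finsupp.single_add]; simp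
    rfl

/-- `τ_j = τ_{α_j}` for `j = 0, …, n`. -/
def τs (j : D.I) : D.𝕃ˣ := D.τ (D.gradIdx j)

/-- The group algebra `𝕃[P]`. -/
abbrev LP : Type _ := AddMonoidAlgebra D.𝕃 D.P

/-- The basis element `X^l` of `𝕃[P]`. -/
def x (l : D.P) : D.LP := AddMonoidAlgebra.single l 1

/-- The Weyl denominator `δ = ∏_{α ∈ R₀} (1 - X^α)`. -/
def δ : D.LP := ∏ i : ι, (1 - D.x (D.rootP i))

/-- The localization `𝒜` of `𝕃[P]` by the Weyl denominator. -/
abbrev A : Type _ := Localization.Away D.δ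

/-- The action of `w ∈ W` on `𝕃[P]`, `X^l ↦ X^{w' l}`. -/
def actLP (w : D.W) : D.LP →ₐ[D.𝕃] D.LP := AddMonoidAlgebra.mapDomainAlgHom D.𝕃 D.𝕃 (D.lin w)

@[simp] lemma actLP_x (w : D.W) (l : D.P) : D.actLP w (D.x l) = D.x (D.lin w l) := by
  simp [actLP, x]

lemma actLP_one : D.actLP 1 = AlgHom.id _ _ := by
  unfold actLP; rw [lin_one]; exact AddMonoidAlgebra.mapDomainAlgHom_id ..

lemma actLP_mul (w w' : D.W) : D.actLP (w * w') = (D.actLP w).comp (D.actLP w') := by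
  unfold actLP; rw [lin_mul]; exact AddMonoidAlgebra.mapDomainAlgHom_comp ..

lemma actLP_δ (w : D.W) : D.actLP w D.δ = D.δ := by
  have h : ∀ i, ∃ j, D.lin w (D.rootP i) = D.rootP j := by
    obtain ⟨_, v, hv, k, _, rfl⟩ := w
    intro i
    obtain ⟨j, hj⟩ := D.W₀_root hv i
    exact ⟨j, Subtype.ext hj⟩
  choose f hf using h
  have hinj : Function.Injective f := by
    intro i j hij
    have h1 : D.lin w (D.rootP i) = D.lin w (D.rootP j) := by rw [hf, hf, hij]
    have h2 := congrArg Subtype.val h1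
    simp only [coe_lin] at h2
    exact D.R₀.root.injective ((w : V ≃ᵃ[ℝ] V).linear.injective h2)
  have hbij : Function.Bijective f := Finite.injective_iff_bijective.1 hinj
  unfold δ
  rw [map_prod, ← hbij.prod_comp (fun i => 1 - D.x (D.rootP i))]
  simp [hf]

/-- The action `f ↦ f^{w'}` of `w ∈ W` on `𝒜`: the extension of the action on `𝕃[P]`. -/
def actA (w : D.W) : D.A →+* D.A :=
  IsLocalization.map (M := Submonoid.powers D.δ) (T := Submonoid.powers D.δ) D.A
    (D.actLP w : D.LP →+* D.LP) (by
      rintro _ ⟨k, rfl⟩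
      exact ⟨k, by simp [D.actLP_δ]⟩)

@[simp] lemma actA_algebraMap (w : D.W) (f : D.LP) :
    D.actA w (algebraMap D.LP D.A f) = algebraMap D.LP D.A (D.actLP w f) :=
  IsLocalization.map_eq _ _

/-- `W` acts on `𝒜` through linear parts. -/
instance : MulSemiringAction D.W D.A where
  smul w f := D.actA w f
  one_smul f := by
    have : D.actA 1 = RingHom.id _ :=
      IsLocalization.ringHom_ext (Submonoid.powers D.δ) (RingHom.ext fun f => by simp [actLP_one])
    exact congrArg (· f) this
  mul_smul w w' f := by
    have : D.actA (w * w') = (D.actA w).comp (D.actA w') :=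
      IsLocalization.ringHom_ext (Submonoid.powers D.δ) (RingHom.ext fun f => by simp [actLP_mul])
    exact congrArg (· f) this
  smul_zero w := map_zero (D.actA w)
  smul_add w := map_add (D.actA w)
  smul_one w := map_one (D.actA w)
  smul_mul w := map_mul (D.actA w)

lemma smul_algebraMap_LP (w : D.W) (f : D.LP) :
    w • (algebraMap D.LP D.A f) = algebraMap D.LP D.A (D.actLP w f) := D.actA_algebraMap w f

/-- `W` acts on `𝒜` by `𝕃`-linear maps. -/
instance : SMulCommClass D.W D.𝕃 D.A where
  smul_comm w r f := by
    rw [Algebra.smul_def, Algebra.smul_def, smul_mul', IsScalarTower.algebraMap_apply D.𝕃 D.LP D.A,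
      smul_algebraMap_LP, AlgHom.commutes]

/-- The smash product `𝒜 # W`: the finite formal sums `∑ f_w w` (`f_w ∈ 𝒜`, `w ∈ W`) with
`(f v) (g w) = f g^{v'} v w`. The element `f w` is `SkewMonoidAlgebra.single w f`. -/
abbrev Smash : Type _ := SkewMonoidAlgebra D.A D.W

/-- The inclusion of `𝒜` in `𝒜 # W`. -/
def ofA (f : D.A) : D.Smash := SkewMonoidAlgebra.single 1 f

/-- The inclusion of `W` in `𝒜 # W`. -/
def ofW (w : D.W) : D.Smash := SkewMonoidAlgebra.single w 1

/-- `1 - X^{-α}` is invertible in `𝒜` for every root `α`. -/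
lemma isUnit_one_sub (j : D.I) : IsUnit (algebraMap D.LP D.A (1 - D.x (-D.αP j))) := by
  have h1 : IsUnit (algebraMap D.LP D.A D.δ) := IsLocalization.Away.algebraMap_isUnit D.δ
  refine isUnit_of_dvd_unit (map_dvd _ ?_) h1
  have h2 : -D.αP j = D.rootP (D.R₀.reflectionPerm (D.gradIdx j) (D.gradIdx j)) := by
    ext; simp [αP, rootP]
  rw [h2]
  exact Finset.dvd_prod_of_mem (fun i => 1 - D.x (D.rootP i)) (Finset.mem_univ _)

/-- The Demazure-Lusztig-type element
`Ť_j = τ_j s_j + (τ_j - τ_j⁻¹) (1 - X^{-α_j})⁻¹ (1 - s_j)` of `𝒜 # W`. -/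
def Tcheck (j : D.I) : D.Smash :=
  (D.τs j : D.𝕃) • D.ofW (D.s j) +
    ((D.τs j : D.𝕃) - (↑(D.τs j)⁻¹ : D.𝕃)) •
      (D.ofA (↑((D.isUnit_one_sub j).unit⁻¹) : D.A) * (1 - D.ofW (D.s j)))

/-! ### The double affine Hecke algebra at critical level -/

/-- The generators `T_j` (`j = 0, …, n`), `T_u` (`u ∈ Ω`), `X^l` (`l ∈ P`). -/
inductive Gen
  | T (j : D.I)
  | U (u : D.Ω)
  | X (l : D.P)

/-- The free `𝕃`-algebra on the generators. -/
abbrev Free : Type _ := FreeAlgebra D.𝕃 D.Gen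

def gT (j : D.I) : D.Free := FreeAlgebra.ι D.𝕃 (Gen.T j)

def gU (u : D.Ω) : D.Free := FreeAlgebra.ι D.𝕃 (Gen.U u)

def gX (l : D.P) : D.Free := FreeAlgebra.ι D.𝕃 (Gen.X l)

/-- The `𝕃`-linear combination of the generators `X^l` given by an element of `𝕃[P]`. -/
def gXlin (f : D.LP) : D.Free := f.coeff.sum fun l r => r • D.gX l

/-- The order of `s_j s_k` in `W`, with value `0` if it is infinite. -/
def coxeterM (j k : D.I) : ℕ := orderOf (D.s j * D.s k)

/-- The defining relations. The relations `T_1 = 1` and `X^0 = 1` express (given the other ones)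
that the generators are invertible. In the braid relation the case of infinite order
(`coxeterM = 0`) is the empty condition `1 = 1`. In the cross relation between `T_j` and `X^l`, the
element `q ∈ 𝕃[P]` is the quotient `(X^l - X^{s_j' l}) / (1 - X^{-α_j})`. -/
inductive Rel : D.Free → D.Free → Prop
  | U_one : Rel (D.gU 1) 1
  | U_mul (u u' : D.Ω) : Rel (D.gU u * D.gU u') (D.gU (u * u'))
  | U_T (u : D.Ω) (j k : D.I) (h : actFn (u : V ≃ᵃ[ℝ] V) (D.a j) = D.a k) :
      Rel (D.gU u * D.gT j) (D.gT k * D.gU u)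
  | quadratic (j : D.I) :
      Rel ((D.gT j - algebraMap D.𝕃 D.Free (D.τs j : D.𝕃)) *
        (D.gT j + algebraMap D.𝕃 D.Free (↑(D.τs j)⁻¹ : D.𝕃))) 0
  | braid (j k : D.I) (h : j ≠ k) :
      Rel (altProd (D.gT j) (D.gT k) (D.coxeterM j k)) (altProd (D.gT k) (D.gT j) (D.coxeterM j k))
  | U_X (u : D.Ω) (l : D.P) : Rel (D.gU u * D.gX l) (D.gX (D.lin u l) * D.gU u)
  | T_X (j : D.I) (l : D.P) (q : D.LP)
      (hq : q * (1 - D.x (-D.αP j)) = D.x l - D.x (D.lin (D.s j) l)) :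
      Rel (D.gT j * D.gX l)
        (D.gX (D.lin (D.s j) l) * D.gT j +
          ((D.τs j : D.𝕃) - (↑(D.τs j)⁻¹ : D.𝕃)) • D.gXlin q)
  | X_zero : Rel (D.gX 0) 1
  | X_add (l l' : D.P) : Rel (D.gX l * D.gX l') (D.gX (l + l'))

/-- The quotient in the cross relation exists. -/
lemma exists_quotient (j : D.I) (l : D.P) :
    ∃ q : D.LP, q * (1 - D.x (-D.αP j)) = D.x l - D.x (D.lin (D.s j) l) := by
  have hx : ∀ k k' : D.P, D.x (k + k') = D.x k * D.x k' := fun k k' => by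
    simp [x, AddMonoidAlgebra.single_mul_single]
  have hpow : ∀ (n : ℕ) (k : D.P), D.x (n • k) = D.x k ^ n := fun n k => by
    simp [x, AddMonoidAlgebra.single_pow]
  obtain ⟨k, hk⟩ := l.2 _ ⟨D.gradIdx j, rfl⟩
  have hs : D.lin (D.s j) l = l + k • (-D.αP j) := by
    ext
    rw [← D.coroot_eq] at hk
    have : ((D.s j : V ≃ᵃ[ℝ] V).linear) (l : V) = D.R₀.reflection (D.gradIdx j) l := rfl
    rw [coe_lin, this, reflection_eq, hk]
    simp [αP, rootP, sub_eq_add_neg, Int.cast_smul_eq_zsmul]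
  suffices h : (1 - D.x (-D.αP j)) ∣ D.x l - D.x (D.lin (D.s j) l) by
    obtain ⟨q, hq⟩ := h
    exact ⟨q, by rw [hq, mul_comm]⟩
  rw [hs]
  obtain ⟨n, rfl | rfl⟩ := k.eq_nat_or_neg
  · rw [hx, natCast_zsmul, hpow]
    have : D.x l - D.x l * D.x (-D.αP j) ^ n = D.x l * (1 - D.x (-D.αP j) ^ n) := by ring
    rw [this]
    exact (one_sub_dvd_one_sub_pow _ n).mul_left _
  · set l' : D.P := l + (-(n : ℤ)) • (-D.αP j) with hl'
    have h2 : l = l' + n • (-D.αP j) := by rw [hl']; simp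
    conv_rhs => rw [h2]
    rw [hx, hpow]
    have : D.x l' * D.x (-D.αP j) ^ n - D.x l' = -D.x l' * (1 - D.x (-D.αP j) ^ n) := by ring
    rw [this]
    exact (one_sub_dvd_one_sub_pow _ n).mul_left _

/-- The double affine Hecke algebra at critical level. -/
abbrev DAHA : Type _ := RingQuot D.Rel

/-- The generator `T_j`. -/
def T (j : D.I) : D.DAHA := RingQuot.mkAlgHom D.𝕃 D.Rel (D.gT j)

/-- The generator `T_u`. -/
def U (u : D.Ω) : D.DAHA := RingQuot.mkAlgHom D.𝕃 D.Rel (D.gU u)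

/-- The generator `X^l`. -/
def X (l : D.P) : D.DAHA := RingQuot.mkAlgHom D.𝕃 D.Rel (D.gX l)

end AffineRootData

end CriticalDAHA

end

/-! Put e_α = 1/(1 - X^{-α}), d_j = τ_j - τ_j⁻¹ and c_j = τ_j - d_j e_{α_j}, so that Ť_j = d_j
e_{α_j} + M_j with M_j = c_j s_j. Uniqueness is clear on generators. Existence means checking
relations, and only the braid relations are hard. At critical level s_0 acts on 𝒜 through its linear
part, so -θ is treated like any simple root and each braid relation depends only on the two Cartan
integers of α_j and α_k. The monomial elements M_j, M_k satisfy the braid relation themselves. Hence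
both alternating products of Ť_j and Ť_k expand over 𝒜 in the same 2m alternating words in M_j, M_k,
and equality of coefficients is a polynomial identity that follows from e_α e_β = e_{α+β}(e_α + e_β
- 1) (`e_mul_e`). This is done for m = 2, 3, 4, 6 (`braid_two`, `braid_three`, `braid_four`,
`braid_six`); the remaining Cartan pair (-2, -2) has m = ∞ and no relation.

Injectivity is a triangularity argument. Fix a point x₀ of the fundamental alcove. The sign of a_j
at w x₀ tells whether s_j shortens w, and the elements without descents are those of Ω. Two distinct
descents j, k of w generate a finite dihedral group whose longest element can be split off from w,
which makes T_w independent of the reduced expression (`isReducedProd_unique`, a version of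
Matsumoto's theorem). The T_w then span ℋ over 𝕃[P] (`exists_eq_sum`). The image of T_w is a nonzero
coefficient times w plus terms of smaller length (`coeff_basicRep_Tw`), since each c_j is nonzero in
the domain 𝒜. In a nontrivial combination of the T_w with coefficients in 𝕃[P], a term of maximal
length therefore survives. -/

open scoped RealInnerProductSpace

noncomputable section

namespace CriticalDAHA

/-! ### Rank-two braid relations for elements `i b + M` over a commutative ring -/

section RankTwo

variable {A R : Type*} [CommRing A] [Ring R]

/-- Since M normalizes A and M² lies in A, left multiplication by b + M preserves the left A-span of
v and M v. Everything below applies this to pairs of alternating words. -/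
theorem mul_pair {i : A →+* R} {M : R} {σ : A →+* A} {e : A}
    (h : ∀ f, M * i f = i (σ f) * M) (h2 : M * M = i e) (b p q : A) (v : R) :
    (i b + M) * (i p * v + i q * (M * v)) =
      i (b * p + e * σ q) * v + i (b * q + σ p) * (M * v) := by
  have h1 : M * (i p * v) = i (σ p) * (M * v) := by rw [← mul_assoc, h, mul_assoc]
  have h3 : M * (i q * (M * v)) = i (e * σ q) * v := by
    rw [← mul_assoc, h, mul_assoc, ← mul_assoc M, h2, ← mul_assoc, ← map_mul, mul_comm e]
  simp only [add_mul, mul_add, h1, h3, map_add]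
  simp only [map_mul, mul_assoc]
  abel

/-- The combination of the 6 alternating products of at most 3 factors `M` and `N`. -/
def dihedralSumThree (i : A →+* R) (M N : R) (p0 p1 q1 p2 q2 p3 : A) : R :=
  i p0 + i p1 * M + i q1 * N + i p2 * (M * N) + i q2 * (N * M) + i p3 * (M * (N * M))

/-- The six words split into pairs v, M v with v = 1, N, N M, and `mul_pair` applies to each. -/
theorem dihedralSumThree_mul_left {i : A →+* R} {M N : R} {σ : A →+* A} {e : A}
    (h : ∀ f, M * i f = i (σ f) * M) (h2 : M * M = i e)
    (b p0 p1 q1 p2 q2 p3 : A) :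
    (i b + M) * dihedralSumThree i M N p0 p1 q1 p2 q2 p3 =
      dihedralSumThree i M N (b * p0 + e * σ p1) (b * p1 + σ p0) (b * q1 + e * σ p2)
          (b * p2 + σ q1) (b * q2 + e * σ p3) (b * p3 + σ q2) := by
  have e0 := mul_pair h h2 b p0 p1 1
  have e1 := mul_pair h h2 b q1 p2 N
  have e2 := mul_pair h h2 b q2 p3 (N * M)
  simp only [mul_one] at e0
  have e := congrArg₂ (· + ·) e0 (congrArg₂ (· + ·) e1 e2)
  simp only [dihedralSumThree, mul_add] at e ⊢
  convert e using 1 <;> abel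

/-- This is again a left multiplication, now by the second generator. The pairs are v, N v with v =
1, M, M N; the braid relation identifies N M N with the word M N M of the last pair. -/
theorem dihedralSumThree_mul_right {i : A →+* R} {M N : R} {τ : A →+* A} {e : A}
    (h : ∀ f, N * i f = i (τ f) * N) (h2 : N * N = i e)
    (hb : M * (N * M) = N * (M * N))
    (b p0 p1 q1 p2 q2 p3 : A) :
    (i b + N) * dihedralSumThree i M N p0 p1 q1 p2 q2 p3 =
      dihedralSumThree i M N (b * p0 + e * τ q1) (b * p1 + e * τ q2) (b * q1 + τ p0)
          (b * p2 + e * τ p3) (b * q2 + τ p1) (b * p3 + τ p2) := by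
  have e0 := mul_pair h h2 b p0 q1 1
  have e1 := mul_pair h h2 b p1 q2 M
  have e2 := mul_pair h h2 b p2 p3 (M * N)
  simp only [mul_one] at e0
  have e := congrArg₂ (· + ·) e0 (congrArg₂ (· + ·) e1 e2)
  simp only [dihedralSumThree, mul_add, hb] at e ⊢
  convert e using 1 <;> abel

/-- The combination of the 8 alternating products of at most 4 factors `M` and `N`. -/
def dihedralSumFour (i : A →+* R) (M N : R) (p0 p1 q1 p2 q2 p3 q3 p4 : A) : R :=
  i p0 + i p1 * M + i q1 * N + i p2 * (M * N) + i q2 * (N * M) + i p3 * (M * (N * M)) + i q3 *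
      (N * (M * N)) + i p4 * (M * (N * (M * N)))

theorem dihedralSumFour_mul_left {i : A →+* R} {M N : R} {σ : A →+* A} {e : A}
    (h : ∀ f, M * i f = i (σ f) * M) (h2 : M * M = i e)
    (b p0 p1 q1 p2 q2 p3 q3 p4 : A) :
    (i b + M) * dihedralSumFour i M N p0 p1 q1 p2 q2 p3 q3 p4 =
      dihedralSumFour i M N (b * p0 + e * σ p1) (b * p1 + σ p0) (b * q1 + e * σ p2)
          (b * p2 + σ q1) (b * q2 + e * σ p3) (b * p3 + σ q2) (b * q3 + e * σ p4) (b * p4 + σ q3)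
              := by
  have e0 := mul_pair h h2 b p0 p1 1
  have e1 := mul_pair h h2 b q1 p2 N
  have e2 := mul_pair h h2 b q2 p3 (N * M)
  have e3 := mul_pair h h2 b q3 p4 (N * (M * N))
  simp only [mul_one] at e0
  have e := congrArg₂ (· + ·) (congrArg₂ (· + ·) e0 e1) (congrArg₂ (· + ·) e2 e3)
  simp only [dihedralSumFour, mul_add] at e ⊢
  convert e using 1 <;> abel

theorem dihedralSumFour_mul_right {i : A →+* R} {M N : R} {τ : A →+* A} {e : A}
    (h : ∀ f, N * i f = i (τ f) * N) (h2 : N * N = i e)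
    (hb : M * (N * (M * N)) = N * (M * (N * M)))
    (b p0 p1 q1 p2 q2 p3 q3 p4 : A) :
    (i b + N) * dihedralSumFour i M N p0 p1 q1 p2 q2 p3 q3 p4 =
      dihedralSumFour i M N (b * p0 + e * τ q1) (b * p1 + e * τ q2) (b * q1 + τ p0)
          (b * p2 + e * τ q3) (b * q2 + τ p1) (b * p3 + e * τ p4) (b * q3 + τ p2) (b * p4 + τ p3)
              := by
  have e0 := mul_pair h h2 b p0 q1 1
  have e1 := mul_pair h h2 b p1 q2 M
  have e2 := mul_pair h h2 b p2 q3 (M * N)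
  have e3 := mul_pair h h2 b p3 p4 (M * (N * M))
  simp only [mul_one] at e0
  have e := congrArg₂ (· + ·) (congrArg₂ (· + ·) e0 e1) (congrArg₂ (· + ·) e2 e3)
  simp only [dihedralSumFour, mul_add, hb] at e ⊢
  convert e using 1 <;> abel

/-- The combination of the 12 alternating products of at most 6 factors `M` and `N`. -/
def dihedralSumSix (i : A →+* R) (M N : R) (p0 p1 q1 p2 q2 p3 q3 p4 q4 p5 q5 p6 : A) : R :=
  i p0 + i p1 * M + i q1 * N + i p2 * (M * N) + i q2 * (N * M) + i p3 * (M * (N * M)) + i q3 *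
      (N * (M * N)) + i p4 * (M * (N * (M * N))) + i q4 * (N * (M * (N * M))) + i p5 *
          (M * (N * (M * (N * M)))) + i q5 * (N * (M * (N * (M * N)))) + i p6 *
              (M * (N * (M * (N * (M * N)))))

theorem dihedralSumSix_mul_left {i : A →+* R} {M N : R} {σ : A →+* A} {e : A}
    (h : ∀ f, M * i f = i (σ f) * M) (h2 : M * M = i e)
    (b p0 p1 q1 p2 q2 p3 q3 p4 q4 p5 q5 p6 : A) :
    (i b + M) * dihedralSumSix i M N p0 p1 q1 p2 q2 p3 q3 p4 q4 p5 q5 p6 =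
      dihedralSumSix i M N (b * p0 + e * σ p1) (b * p1 + σ p0) (b * q1 + e * σ p2) (b * p2 + σ q1)
          (b * q2 + e * σ p3) (b * p3 + σ q2) (b * q3 + e * σ p4) (b * p4 + σ q3)
              (b * q4 + e * σ p5) (b * p5 + σ q4) (b * q5 + e * σ p6) (b * p6 + σ q5) := by
  have e0 := mul_pair h h2 b p0 p1 1
  have e1 := mul_pair h h2 b q1 p2 N
  have e2 := mul_pair h h2 b q2 p3 (N * M)
  have e3 := mul_pair h h2 b q3 p4 (N * (M * N))
  have e4 := mul_pair h h2 b q4 p5 (N * (M * (N * M)))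
  have e5 := mul_pair h h2 b q5 p6 (N * (M * (N * (M * N))))
  simp only [mul_one] at e0
  have e := congrArg₂ (· + ·) (congrArg₂ (· + ·) e0 (congrArg₂ (· + ·) e1 e2))
      (congrArg₂ (· + ·) e3 (congrArg₂ (· + ·) e4 e5))
  simp only [dihedralSumSix, mul_add] at e ⊢
  convert e using 1 <;> abel

theorem dihedralSumSix_mul_right {i : A →+* R} {M N : R} {τ : A →+* A} {e : A}
    (h : ∀ f, N * i f = i (τ f) * N) (h2 : N * N = i e)
    (hb : M * (N * (M * (N * (M * N)))) = N * (M * (N * (M * (N * M)))))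
    (b p0 p1 q1 p2 q2 p3 q3 p4 q4 p5 q5 p6 : A) :
    (i b + N) * dihedralSumSix i M N p0 p1 q1 p2 q2 p3 q3 p4 q4 p5 q5 p6 =
      dihedralSumSix i M N (b * p0 + e * τ q1) (b * p1 + e * τ q2) (b * q1 + τ p0)
          (b * p2 + e * τ q3) (b * q2 + τ p1) (b * p3 + e * τ q4) (b * q3 + τ p2)
              (b * p4 + e * τ q5) (b * q4 + τ p3) (b * p5 + e * τ p6) (b * q5 + τ p4)
                  (b * p6 + τ p5) := by
  have e0 := mul_pair h h2 b p0 q1 1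
  have e1 := mul_pair h h2 b p1 q2 M
  have e2 := mul_pair h h2 b p2 q3 (M * N)
  have e3 := mul_pair h h2 b p3 q4 (M * (N * M))
  have e4 := mul_pair h h2 b p4 q5 (M * (N * (M * N)))
  have e5 := mul_pair h h2 b p5 p6 (M * (N * (M * (N * M))))
  simp only [mul_one] at e0
  have e := congrArg₂ (· + ·) (congrArg₂ (· + ·) e0 (congrArg₂ (· + ·) e1 e2))
      (congrArg₂ (· + ·) e3 (congrArg₂ (· + ·) e4 e5))
  simp only [dihedralSumSix, mul_add, hb] at e ⊢
  convert e using 1 <;> abel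

theorem braid_two {i : A →+* R} {M N : R} {σ τ : A →+* A}
    (hM : ∀ f, M * i f = i (σ f) * M) (hN : ∀ f, N * i f = i (τ f) * N)
    (hb : M * N = N * M) {b c : A} (hσ : σ c = c) (hτ : τ b = b) :
    altProd (i b + M) (i c + N) 2 = altProd (i c + N) (i b + M) 2 := by
  simp only [altProd, mul_one, add_mul, mul_add, hM, hN, hb, hσ, hτ, ← map_mul, mul_comm c]
  abel

/-- Type A₂: in the application u0, u1, u2 are the elements e_α for α = α_j, α_k, α_j + α_k, and
`h1` is their addition formula. -/
theorem braid_three {i : A →+* R} {M N : R} {σ τ : A →+* A} {a u0 u1 u2 : A}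
    (hM : ∀ f, M * i f = i (σ f) * M) (hN : ∀ f, N * i f = i (τ f) * N)
    (hM2 : M * M = i (1 + a ^ 2 * (u0 * (1 - u0)))) (hN2 : N * N = i (1 + a ^ 2 * (u1 * (1 - u1))))
    (hb : M * (N * M) = N * (M * N))
    (hσa : σ a = a) (hσ0 : σ u0 = 1 - u0) (hσ1 : σ u1 = u2) (hσ2 : σ u2 = u1)
    (hτa : τ a = a) (hτ0 : τ u0 = u2) (hτ1 : τ u1 = 1 - u1) (hτ2 : τ u2 = u0)
    (h1 : u0 * u1 = u2 * (u0 + u1 - 1)) :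
    altProd (i (a * u0) + M) (i (a * u1) + N) 3 =
      altProd (i (a * u1) + N) (i (a * u0) + M) 3 := by
  -- The empty product at the end of `altProd` is written in the span of the words, so that the
  -- factors can be absorbed one at a time.
  have h : (1 : R) = dihedralSumThree i M N 1 0 0 0 0 0 := by simp [dihedralSumThree]
  simp only [altProd]
  rw [h]
  simp only [dihedralSumThree_mul_left hM hM2, dihedralSumThree_mul_right hN hN2 hb]
  simp only [map_mul, map_one, map_zero, mul_zero, mul_one, add_zero, zero_add, hσa, hσ0, hσ1, hσ2,
    hτa, hτ0, hτ1, hτ2]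
  clear hM hN hM2 hN2 hb h hσa hσ0 hσ1 hσ2 hτa hτ0 hτ1 hτ2
  congr 1
  -- What remains are the coefficients of the six words: identities in the commutative ring A modulo
  -- the addition formula.
  all_goals first | ring1 | grind

/-- Type B₂ with α_j short: u2 and u3 belong to α_j + α_k and 2α_j + α_k, and `h1`, `h2` are the
addition formulas for the two ways of obtaining a root by adding α_j. -/
theorem braid_four {i : A →+* R} {M N : R} {σ τ : A →+* A} {a b u0 u1 u2 u3 : A}
    (hM : ∀ f, M * i f = i (σ f) * M) (hN : ∀ f, N * i f = i (τ f) * N)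
    (hM2 : M * M = i (1 + a ^ 2 * (u0 * (1 - u0)))) (hN2 : N * N = i (1 + b ^ 2 * (u1 * (1 - u1))))
    (hb : M * (N * (M * N)) = N * (M * (N * M)))
    (hσa : σ a = a) (hσb : σ b = b) (hσ0 : σ u0 = 1 - u0) (hσ1 : σ u1 = u3) (hσ2 : σ u2 = u2)
    (hσ3 : σ u3 = u1)
    (hτa : τ a = a) (hτb : τ b = b) (hτ0 : τ u0 = u2) (hτ1 : τ u1 = 1 - u1) (hτ2 : τ u2 = u0)
    (hτ3 : τ u3 = u3)
    (h1 : u0 * u1 = u2 * (u0 + u1 - 1)) (h2 : u0 * u2 = u3 * (u0 + u2 - 1)) :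
    altProd (i (a * u0) + M) (i (b * u1) + N) 4 =
      altProd (i (b * u1) + N) (i (a * u0) + M) 4 := by
  have h : (1 : R) = dihedralSumFour i M N 1 0 0 0 0 0 0 0 := by simp [dihedralSumFour]
  simp only [altProd]
  rw [h]
  simp only [dihedralSumFour_mul_left hM hM2, dihedralSumFour_mul_right hN hN2 hb]
  simp only [map_add, map_sub, map_mul, map_pow, map_one, map_zero, mul_zero, mul_one, add_zero,
    zero_add, hσa, hσb, hσ0, hσ1, hσ2, hσ3, hτa, hτb, hτ0, hτ1, hτ2, hτ3]
  clear hM hN hM2 hN2 hb h hσa hσb hσ0 hσ1 hσ2 hσ3 hτa hτb hτ0 hτ1 hτ2 hτ3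
  congr 1
  all_goals first | ring1 | grind

/-- Type G₂ with α_j short: u2, u3, u4, u5 belong to α_j + α_k, 2α_j + α_k, 3α_j + α_k, 3α_j + 2α_k,
and `h1` to `h5` are addition formulas among the six positive roots. -/
theorem braid_six {i : A →+* R} {M N : R} {σ τ : A →+* A} {a b u0 u1 u2 u3 u4 u5 : A}
    (hM : ∀ f, M * i f = i (σ f) * M) (hN : ∀ f, N * i f = i (τ f) * N)
    (hM2 : M * M = i (1 + a ^ 2 * (u0 * (1 - u0)))) (hN2 : N * N = i (1 + b ^ 2 * (u1 * (1 - u1))))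
    (hb : M * (N * (M * (N * (M * N)))) = N * (M * (N * (M * (N * M)))))
    (hσa : σ a = a) (hσb : σ b = b) (hσ0 : σ u0 = 1 - u0) (hσ1 : σ u1 = u4) (hσ2 : σ u2 = u3)
    (hσ3 : σ u3 = u2) (hσ4 : σ u4 = u1) (hσ5 : σ u5 = u5)
    (hτa : τ a = a) (hτb : τ b = b) (hτ0 : τ u0 = u2) (hτ1 : τ u1 = 1 - u1) (hτ2 : τ u2 = u0)
    (hτ3 : τ u3 = u3) (hτ4 : τ u4 = u5) (hτ5 : τ u5 = u4)
    (h1 : u0 * u1 = u2 * (u0 + u1 - 1)) (h2 : u0 * u2 = u3 * (u0 + u2 - 1))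
    (h3 : u0 * u3 = u4 * (u0 + u3 - 1)) (h4 : u4 * u1 = u5 * (u4 + u1 - 1))
    (h5 : u2 * u3 = u5 * (u2 + u3 - 1)) :
    altProd (i (a * u0) + M) (i (b * u1) + N) 6 =
      altProd (i (b * u1) + N) (i (a * u0) + M) 6 := by
  have h : (1 : R) = dihedralSumSix i M N 1 0 0 0 0 0 0 0 0 0 0 0 := by simp [dihedralSumSix]
  simp only [altProd]
  rw [h]
  simp only [dihedralSumSix_mul_left hM hM2, dihedralSumSix_mul_right hN hN2 hb]
  simp only [map_add, map_sub, map_mul, map_pow, map_one, map_zero, mul_zero, mul_one, add_zero,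
    zero_add, hσa, hσb, hσ0, hσ1, hσ2, hσ3, hσ4, hσ5, hτa, hτb, hτ0, hτ1, hτ2, hτ3, hτ4, hτ5]
  clear hM hN hM2 hN2 hb h hσa hσb hσ0 hσ1 hσ2 hσ3 hσ4 hσ5 hτa hτb hτ0 hτ1 hτ2 hτ3 hτ4 hτ5
  congr 1
  all_goals first | ring1 | grind

end RankTwo

namespace AffineRootData

variable {ι V : Type*} [Fintype ι] [NormedAddCommGroup V] [InnerProductSpace ℝ V]
  (D : AffineRootData ι V)

/-! ### The finite root system -/

instance : D.R₀.IsRootSystem := D.isRootSystem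
instance : D.R₀.IsCrystallographic := D.isCrystallographic
instance : D.R₀.IsReduced := D.isReduced
instance : D.R₀.IsIrreducible := D.isIrreducible

/-- The Cartan integer `⟨α, β^∨⟩`. -/
abbrev cartan (i j : ι) : ℤ := D.R₀.pairingIn ℤ i j

lemma cartan_cast (i j : ι) : (D.cartan i j : ℝ) = ⟪D.R₀.root i, D.R₀.coroot j⟫ := by
  rw [← D.pairing_eq, ← D.R₀.algebraMap_pairingIn ℤ]; rfl

lemma cartan_mul (i j : ι) :
    (D.cartan i j : ℝ) * ⟪D.R₀.root j, D.R₀.root j⟫ = 2 * ⟪D.R₀.root i, D.R₀.root j⟫ := by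
  have h := (D.root_inner_pos j).ne'
  rw [cartan_cast, coroot_eq, real_inner_smul_right]
  field_simp

lemma reflection_root (i j : ι) :
    D.R₀.root (D.R₀.reflectionPerm j i) = D.R₀.root i - (D.cartan i j : ℝ) • D.R₀.root j := by
  rw [RootPairing.root_reflectionPerm, reflection_eq, cartan_cast]

lemma inner_reflection (i j k : ι) :
    ⟪D.R₀.root (D.R₀.reflectionPerm j i), D.R₀.root (D.R₀.reflectionPerm j k)⟫ =
      ⟪D.R₀.root i, D.R₀.root k⟫ := by
  simp only [RootPairing.root_reflectionPerm]
  exact D.W₀_inner (Subgroup.subset_closure ⟨j, rfl⟩) _ _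

/-- The index of the root `-α`. -/
def neg (i : ι) : ι := D.R₀.reflectionPerm i i

@[simp] lemma root_neg (i : ι) : D.R₀.root (D.neg i) = -D.R₀.root i := by simp [neg]

@[simp] lemma cartan_neg_left (i j : ι) : D.cartan (D.neg i) j = -D.cartan i j := by
  simp [neg, cartan]

@[simp] lemma cartan_neg_right (i j : ι) : D.cartan i (D.neg j) = -D.cartan i j := by
  simp [neg, cartan]

lemma m_eq_of_inner_eq {i j : ι}
    (h : ⟪D.R₀.root i, D.R₀.root i⟫ = ⟪D.R₀.root j, D.R₀.root j⟫) : D.m i = D.m j := by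
  unfold m; rw [h]

@[simp] lemma m_neg (i : ι) : D.m (D.neg i) = D.m i := D.m_eq_of_inner_eq (by simp)

lemma one_le_m (i : ι) : 1 ≤ D.m i := by
  have h := D.θ_highest
  unfold m
  split
  · exact le_rfl
  · rename_i ht
    rw [ht] at h
    exact (one_le_div (D.root_inner_pos _)).2 (h.1 i)

lemma isPos_neg_iff (i : ι) : D.base.IsPos (D.neg i) ↔ ¬ D.base.IsPos i :=
  RootPairing.Base.IsPos.neg_iff_not D.base i

/-- The points at which all simple roots are positive. -/
def Dominant (y : V) : Prop := ∀ j ∈ D.base.support, 0 < ⟪D.R₀.root j, y⟫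

variable {D}

lemma Dominant.pos {y : V} (hy : D.Dominant y) {i : ι} (hi : D.base.IsPos i) :
    0 < ⟪D.R₀.root i, y⟫ := by
  refine hi.induction_on_add hy fun i j k hk h hj => ?_
  rw [hk, inner_add_left]
  exact add_pos h (hy j hj)

lemma Dominant.isPos {y : V} (hy : D.Dominant y) {i : ι} (hi : 0 ≤ ⟪D.R₀.root i, y⟫) :
    D.base.IsPos i := by
  by_contra h
  rw [← isPos_neg_iff] at h
  have := hy.pos h
  rw [root_neg, inner_neg_left] at this
  linarith

variable (D)

lemma inner_nonneg_of_isPos {y : V} (hy : ∀ j ∈ D.base.support, 0 ≤ ⟪D.R₀.root j, y⟫) {i : ι}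
    (hi : D.base.IsPos i) : 0 ≤ ⟪D.R₀.root i, y⟫ := by
  refine hi.induction_on_add hy fun i j k hk h hj => ?_
  rw [hk, inner_add_left]
  exact add_nonneg h (hy j hj)

/-- The cone of the nonnegative integral combinations of simple roots. -/
abbrev cone : AddSubmonoid V := AddSubmonoid.closure (D.R₀.root '' D.base.support)

lemma inner_nonneg_of_mem_cone {y : V} (hy : ∀ j ∈ D.base.support, 0 ≤ ⟪D.R₀.root j, y⟫) {v : V}
    (hv : v ∈ D.cone) : 0 ≤ ⟪v, y⟫ := by
  induction hv using AddSubmonoid.closure_induction with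
  | mem v hv => obtain ⟨j, hj, rfl⟩ := hv; exact hy j hj
  | zero => simp
  | add v w _ _ h1 h2 => rw [inner_add_left]; exact add_nonneg h1 h2

variable {D} in
lemma Dominant.eq_zero {y : V} (hy : D.Dominant y) {v : V} (hv : v ∈ D.cone) (h : ⟪v, y⟫ = 0) :
    v = 0 := by
  induction hv using AddSubmonoid.closure_induction with
  | mem v hv => obtain ⟨j, hj, rfl⟩ := hv; exact absurd h (hy j hj).ne'
  | zero => rfl
  | add v w hv hw h1 h2 =>
    have h3 := D.inner_nonneg_of_mem_cone (fun j hj => (hy j hj).le) hv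
    have h4 := D.inner_nonneg_of_mem_cone (fun j hj => (hy j hj).le) hw
    rw [inner_add_left] at h
    rw [h1 (by linarith), h2 (by linarith), add_zero]

lemma exists_dominant : ∃ y, D.Dominant y := by
  have hp : D.R₀.toLinearMap.IsPerfPair := D.R₀.isPerfPair_toLinearMap
  rw [D.toLinearMap_eq] at hp
  -- The linear functional with value 1 on every simple root is represented by a vector.
  obtain ⟨y, hy⟩ := hp.bijective_right.2 (D.base.toWeightBasis.constr ℝ fun _ => (1 : ℝ))
  refine ⟨y, fun j hj => ?_⟩
  have h := congrArg (· (D.R₀.root j)) hy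
  have h2 := D.base.toWeightBasis.constr_basis ℝ (fun _ => (1 : ℝ)) ⟨j, hj⟩
  rw [RootPairing.Base.toWeightBasis_apply] at h2
  simp only [LinearMap.flip_apply, innerₗ_apply_apply, h2] at h
  rw [h]; exact one_pos

/-- The root s_j θ is as long as θ, so in both types θ - s_j θ = ⟨θ, α_j^∨⟩ α_j is a nonnegative
combination of simple roots. -/
lemma cartan_θ_nonneg {j : ι} (hj : j ∈ D.base.support) : 0 ≤ D.cartan D.θ j := by
  obtain ⟨y, hy⟩ := D.exists_dominant
  have h : D.R₀.root D.θ - D.R₀.root (D.R₀.reflectionPerm j D.θ) ∈ D.cone := by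
    have h0 := D.θ_highest
    split at h0
    · exact h0 _
    · exact h0.2 _ (D.inner_reflection _ _ _)
  have h1 := D.inner_nonneg_of_mem_cone (fun j hj => (hy j hj).le) h
  rw [reflection_root, sub_sub_cancel, real_inner_smul_left] at h1
  exact_mod_cast nonneg_of_mul_nonneg_left h1 (hy j hj)

lemma inner_root_nonneg_of_cartan {i j : ι} (h : 0 ≤ D.cartan i j) :
    0 ≤ ⟪D.R₀.root i, D.R₀.root j⟫ := by
  have h1 := D.cartan_mul i j
  have h2 := D.root_inner_pos j
  have h3 : (0 : ℝ) ≤ D.cartan i j := by exact_mod_cast h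
  nlinarith [mul_nonneg h3 h2.le]

lemma cartan_pos_iff {i j : ι} : 0 < D.cartan i j ↔ 0 < ⟪D.R₀.root i, D.R₀.root j⟫ := by
  have h1 := D.cartan_mul i j
  have h2 := D.root_inner_pos j
  rw [← Int.cast_pos (R := ℝ)]
  constructor
  · intro h
    have := mul_pos h h2
    linarith
  · intro h
    exact pos_of_mul_pos_left (by linarith) h2.le

/-- As θ is dominant, negative roots have nonpositive inner product with it. -/
lemma isPos_of_cartan_θ_pos {i : ι} (h : 0 < D.cartan i D.θ) : D.base.IsPos i := by
  by_contra h1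
  rw [← isPos_neg_iff] at h1
  have h2 := D.inner_nonneg_of_isPos (y := D.R₀.root D.θ) (fun j hj => by
    rw [real_inner_comm]
    exact D.inner_root_nonneg_of_cartan (D.cartan_θ_nonneg hj)) h1
  rw [D.cartan_pos_iff] at h
  rw [root_neg, inner_neg_left] at h2
  linarith

lemma isPos_θ : D.base.IsPos D.θ := D.isPos_of_cartan_θ_pos (by simp [cartan])

/-- The strings through `θ` are short: `⟨α, θ^∨⟩ ≤ m_α` for `α ≠ θ`. -/
lemma cartan_θ_le_m {i : ι} (hi : i ≠ D.θ) : (D.cartan i D.θ : ℝ) ≤ D.m i := by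
  by_cases hpos : 0 < D.cartan i D.θ
  swap
  · have : (D.cartan i D.θ : ℝ) ≤ 0 := by exact_mod_cast not_lt.1 hpos
    linarith [D.one_le_m i]
  have hθ := D.θ_highest
  cases ht : D.type with
  | untwisted =>
    rw [ht] at hθ
    obtain ⟨y, hy⟩ := D.exists_dominant
    have hm : D.m i = 1 := by unfold m; rw [ht]
    rw [hm]
    by_contra! h
    have h2 : (2 : ℝ) ≤ D.cartan i D.θ := by
      have : 1 < D.cartan i D.θ := by exact_mod_cast h
      exact_mod_cast this
    have h3 := D.inner_nonneg_of_mem_cone (fun j hj => (hy j hj).le) (hθ i)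
    have h4 := D.inner_nonneg_of_mem_cone (fun j hj => (hy j hj).le)
      (hθ (D.neg (D.R₀.reflectionPerm D.θ i)))
    have h5 := hy.pos D.isPos_θ
    rw [root_neg, reflection_root] at h4
    simp only [inner_sub_left, inner_neg_left, real_inner_smul_left] at h3 h4
    refine hi (D.R₀.root.injective (sub_eq_zero.1 (hy.eq_zero (hθ i) ?_)).symm)
    rw [inner_sub_left]
    nlinarith [mul_nonneg (sub_nonneg.2 h2) h5.le]
  | twisted =>
    have hm : D.m i = ⟪D.R₀.root i, D.R₀.root i⟫ / ⟪D.R₀.root D.θ, D.R₀.root D.θ⟫ := by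
      unfold m; rw [ht]
    have h0 := D.root_inner_pos D.θ
    have h1 := D.cartan_mul i D.θ
    have h2 := D.cartan_mul D.θ i
    have h1m := D.one_le_m i
    rw [real_inner_comm (D.R₀.root i) (D.R₀.root D.θ), ← h1] at h2
    have h3 : (D.cartan i D.θ : ℝ) = D.cartan D.θ i * D.m i := by
      rw [hm]; field_simp; linarith
    have hne : D.R₀.root i ≠ D.R₀.root D.θ := fun h => hi (D.R₀.root.injective h)
    have hne' : D.R₀.root i ≠ -D.R₀.root D.θ := by
      intro h
      rw [D.cartan_pos_iff, h, inner_neg_left] at hpos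
      linarith
    have h4 := D.R₀.pairingIn_pairingIn_mem_set_of_isCrystal_of_isRed' i D.θ hne hne'
    -- By `h3` it is enough to bound ⟨θ, α^∨⟩. For nonproportional roots one of the two Cartan
    -- integers has absolute value at most 1, and θ is not the longer root.
    have h5 : D.cartan D.θ i ≤ 1 := by
      by_contra! h5
      have h6 : D.cartan i D.θ = 1 ∧ 1 < D.cartan D.θ i := by
        simp only [Set.mem_insert_iff, Set.mem_singleton_iff, Prod.mk.injEq] at h4
        refine ⟨?_, h5⟩
        change 0 < D.R₀.pairingIn ℤ i D.θ at hpos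
        change 1 < D.R₀.pairingIn ℤ D.θ i at h5
        change D.R₀.pairingIn ℤ i D.θ = 1
        lia
      rw [h6.1] at h3
      have : (1 : ℝ) < D.cartan D.θ i := by exact_mod_cast h6.2
      push_cast at h3
      nlinarith
    have : (D.cartan D.θ i : ℝ) ≤ 1 := by exact_mod_cast h5
    rw [h3]
    nlinarith

/-- The inner product, as an invariant form. -/
def invariantForm : D.R₀.InvariantForm where
  form := innerₗ V
  symm := ⟨fun x y => by simp [real_inner_comm]⟩
  ne_zero i := by simpa using D.R₀.ne_zero i
  isOrthogonal_reflection i x y := by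
    simpa using D.W₀_inner (Subgroup.subset_closure ⟨i, rfl⟩) x y

variable {D} in
/-- On the dominant chamber, `α ≤ m_α θ` for all roots `α`. -/
lemma Dominant.le_θ {y : V} (hy : D.Dominant y) (i : ι) :
    ⟪D.R₀.root i, y⟫ ≤ D.m i * ⟪D.R₀.root D.θ, y⟫ := by
  have hθ := D.θ_highest
  have hy' : ∀ j ∈ D.base.support, 0 ≤ ⟪D.R₀.root j, y⟫ := fun j hj => (hy j hj).le
  cases ht : D.type with
  | untwisted =>
    rw [ht] at hθ
    have hm : D.m i = 1 := by unfold m; rw [ht]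
    have := D.inner_nonneg_of_mem_cone hy' (hθ i)
    rw [inner_sub_left] at this
    rw [hm]; linarith
  | twisted =>
    rw [ht] at hθ
    -- It suffices to treat a root k of the given length with maximal value at y. Reflections
    -- preserve lengths, so such a root is dominant.
    obtain ⟨k, hk, hmax⟩ := Set.exists_max_image
      {k | ⟪D.R₀.root k, D.R₀.root k⟫ = ⟪D.R₀.root i, D.R₀.root i⟫}
      (fun k => ⟪D.R₀.root k, y⟫) (Set.toFinite _) ⟨i, rfl⟩
    refine (hmax i rfl).trans ?_
    rw [← D.m_eq_of_inner_eq hk]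
    have hdom : ∀ j ∈ D.base.support, 0 ≤ ⟪D.R₀.root j, D.R₀.root k⟫ := by
      intro j hj
      have h1 := hmax (D.R₀.reflectionPerm j k) ((D.inner_reflection _ _ _).trans hk)
      simp only [reflection_root, inner_sub_left, real_inner_smul_left] at h1
      have h2 : (0 : ℝ) ≤ D.cartan k j := nonneg_of_mul_nonneg_left (by linarith) (hy j hj)
      rw [real_inner_comm]
      exact D.inner_root_nonneg_of_cartan (by exact_mod_cast h2)
    -- By irreducibility some root of the length of θ is not orthogonal to k. As θ is highest among
    -- these roots and k is dominant, ⟨θ, k⟩ > 0 follows.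
    obtain ⟨l, hl, hl'⟩ : ∃ l, ⟪D.R₀.root l, D.R₀.root l⟫ = ⟪D.R₀.root D.θ, D.R₀.root D.θ⟫ ∧
        0 < ⟪D.R₀.root l, D.R₀.root k⟫ := by
      obtain ⟨l, hl, hl'⟩ := D.R₀.exists_form_eq_form_and_form_ne_zero D.invariantForm k D.θ
      simp only [invariantForm, innerₗ_apply_apply] at hl hl'
      rw [real_inner_comm] at hl'
      rcases lt_or_gt_of_ne hl' with h | h
      · exact ⟨D.neg l, by simpa using hl, by simpa using h⟩
      · exact ⟨l, hl, h⟩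
    have h1 := D.inner_nonneg_of_mem_cone hdom (hθ.2 l hl)
    rw [inner_sub_left] at h1
    have h2 : 0 < D.cartan k D.θ := by
      rw [D.cartan_pos_iff, real_inner_comm]; linarith
    by_cases hkθ : k = D.θ
    · rw [hkθ]
      have := hy.pos D.isPos_θ
      nlinarith [D.one_le_m D.θ]
    have h3 := D.cartan_θ_le_m hkθ
    -- The root -s_θ k has the same positive Cartan integer with θ as k, so it is positive. Hence
    -- k(y) < ⟨k, θ^∨⟩ θ(y) ≤ m_k θ(y).
    have h4 : ¬ D.base.IsPos (D.R₀.reflectionPerm D.θ k) := by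
      rw [← isPos_neg_iff]
      refine D.isPos_of_cartan_θ_pos ?_
      have h5 := D.cartan_neg_right k D.θ
      rw [neg, cartan, D.R₀.pairingIn_reflectionPerm] at h5
      rw [cartan_neg_left, cartan, h5, neg_neg]
      exact h2
    have h5 := mt hy.isPos h4
    rw [reflection_root, inner_sub_left, real_inner_smul_left] at h5
    have := hy.pos D.isPos_θ
    nlinarith

/-! ### Affine roots and the length function -/

lemma coe_mul_apply (w w' : D.W) (x : V) :
    ((w * w' : D.W) : V ≃ᵃ[ℝ] V) x = (w : V ≃ᵃ[ℝ] V) ((w' : V ≃ᵃ[ℝ] V) x) := rfl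

lemma s_apply (j : D.I) (x : V) :
    (D.s j : V ≃ᵃ[ℝ] V) x = x - D.a j x • D.R₀.coroot (D.gradIdx j) :=
  D.affineReflection_apply _ _ _

lemma a_sub_smul_coroot (j : D.I) (i : ι) (x : V) (r : ℝ) :
    D.a j (x - r • D.R₀.coroot i) = D.a j x - r * D.cartan (D.gradIdx j) i := by
  simp only [a, affineFn_apply, inner_sub_right, real_inner_smul_right, cartan_cast, α]
  ring

/-- The Cartan integer of two simple affine roots. -/
abbrev affineCartan (j k : D.I) : ℤ := D.cartan (D.gradIdx j) (D.gradIdx k)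

lemma a_s (j k : D.I) (x : V) :
    D.a j ((D.s k : V ≃ᵃ[ℝ] V) x) = D.a j x - D.a k x * D.affineCartan j k := by
  rw [s_apply, a_sub_smul_coroot]

lemma a_s_self (j : D.I) (x : V) : D.a j ((D.s j : V ≃ᵃ[ℝ] V) x) = -D.a j x := by
  rw [a_s, affineCartan, cartan, RootPairing.pairingIn_same]; push_cast; ring

@[simp] lemma s_mul_self (j : D.I) : D.s j * D.s j = 1 := by
  ext x
  rw [coe_mul_apply, s_apply, a_s_self, s_apply]
  simp

@[simp] lemma s_mul_s_mul (j : D.I) (w : D.W) : D.s j * (D.s j * w) = w := by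
  rw [← mul_assoc, s_mul_self, one_mul]

lemma s_s_apply (j : D.I) (x : V) :
    (D.s j : V ≃ᵃ[ℝ] V) ((D.s j : V ≃ᵃ[ℝ] V) x) = x := by
  rw [← coe_mul_apply, s_mul_self]; rfl

lemma hatP_inner {l : V} (hl : l ∈ D.hatP) (i : ι) : ∃ n : ℤ, ⟪D.R₀.root i, l⟫ = D.m i * n := by
  obtain ⟨n, hn⟩ := hl _ ⟨i, rfl⟩
  refine ⟨n, ?_⟩
  have h := (D.root_inner_pos i).ne'
  have hm := (D.m_pos i).ne'
  dsimp only at hn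
  rw [← hn, D.coroot_eq, real_inner_comm]
  simp only [real_inner_smul_left, real_inner_smul_right]
  field_simp

lemma actFn_apply (w : D.W) (f : V →ᵃ[ℝ] ℝ) (x : V) :
    actFn (w : V ≃ᵃ[ℝ] V) f x = f (((w⁻¹ : D.W) : V ≃ᵃ[ℝ] V) x) := rfl

/-- Linear parts permute the roots and preserve m_α; a translation by c l with l ∈ P̂ changes the
constant term by an integer multiple of m_α c, by `hatP_inner`. -/
lemma actFn_mem (w : D.W) {f : V →ᵃ[ℝ] ℝ} (hf : f ∈ D.affineRoots) :
    actFn (w : V ≃ᵃ[ℝ] V) f ∈ D.affineRoots := by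
  obtain ⟨i, r, rfl⟩ := hf
  obtain ⟨v, hv, l, hl, h⟩ := (w⁻¹).2
  obtain ⟨k, hk⟩ := D.W₀_root (D.W₀.inv_mem hv) i
  obtain ⟨n, hn⟩ := D.hatP_inner hl k
  have hin : ∀ x, ⟪D.R₀.root i, v x⟫ = ⟪D.R₀.root k, x⟫ := fun x => by
    have h1 := D.W₀_inner hv (v⁻¹ (D.R₀.root i)) x
    rw [← LinearEquiv.mul_apply, mul_inv_cancel] at h1
    rw [← hk]
    exact h1
  have hm : D.m i = D.m k := D.m_eq_of_inner_eq (by rw [← hk, D.W₀_inner (D.W₀.inv_mem hv)])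
  refine ⟨k, r + n, AffineMap.ext fun x => ?_⟩
  rw [actFn_apply, h]
  simp only [AffineEquiv.coe_mul, Function.comp, t_apply, LinearEquiv.coe_toAffineEquiv,
    affineFn_apply, hin, inner_add_right, real_inner_smul_right, hn, hm]
  push_cast
  ring

lemma neg_mem_affineRoots {f : V →ᵃ[ℝ] ℝ} (hf : f ∈ D.affineRoots) : -f ∈ D.affineRoots := by
  obtain ⟨i, r, rfl⟩ := hf
  refine ⟨D.neg i, -r, AffineMap.ext fun x => ?_⟩
  change -(affineFn _ _ x) = _
  simp only [affineFn_apply, root_neg, inner_neg_left, m_neg]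
  push_cast
  ring

lemma exists_alcove_point : ∃ x, D.Dominant x ∧ ∀ i, |⟪D.R₀.root i, x⟫| < D.c := by
  obtain ⟨y, hy⟩ := D.exists_dominant
  -- Scaling a dominant vector by c / M makes all roots smaller than c in absolute value; the
  -- summand 1 makes the inequality strict and M positive.
  set M := 1 + ∑ i, |⟪D.R₀.root i, y⟫| with hM
  have hMpos : 0 < M := by positivity
  refine ⟨(D.c / M) • y, fun j hj => ?_, fun i => ?_⟩
  · rw [real_inner_smul_right]
    exact mul_pos (div_pos D.c_pos hMpos) (hy j hj)
  · have h := Finset.single_le_sum (f := fun i => |⟪D.R₀.root i, y⟫|) (fun _ _ => abs_nonneg _)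
      (Finset.mem_univ i)
    rw [real_inner_smul_right, abs_mul, abs_of_pos (div_pos D.c_pos hMpos), div_mul_eq_mul_div,
      div_lt_iff₀ hMpos]
    have := D.c_pos
    have h' : |⟪D.R₀.root i, y⟫| < M := by rw [hM]; linarith
    nlinarith

/-- A point of the fundamental alcove. -/
def x₀ : V := D.exists_alcove_point.choose

lemma dominant_x₀ : D.Dominant D.x₀ := D.exists_alcove_point.choose_spec.1

lemma abs_inner_x₀_lt (i : ι) : |⟪D.R₀.root i, D.x₀⟫| < D.m i * D.c := by
  have h := D.exists_alcove_point.choose_spec.2 i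
  have := D.c_pos
  have := D.one_le_m i
  exact h.trans_le (by nlinarith)

/-- Near the origin in the dominant chamber the sign of α + m_α r c is that of r, or of α if r = 0.
With the next lemma this identifies the affine roots positive at x₀. -/
lemma affineFn_pos {i : ι} {r : ℤ} (h : 1 ≤ r ∨ (r = 0 ∧ D.base.IsPos i)) :
    0 < affineFn (D.R₀.root i) (D.m i * r * D.c) D.x₀ := by
  rw [affineFn_apply]
  rcases h with h | ⟨rfl, h⟩
  · have h1 := (abs_lt.1 (D.abs_inner_x₀_lt i)).1
    have h2 : (1 : ℝ) ≤ r := by exact_mod_cast h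
    nlinarith [mul_pos (D.m_pos i) D.c_pos]
  · simpa using D.dominant_x₀.pos h

lemma affineFn_x₀_ne_zero (i : ι) (r : ℤ) :
    affineFn (D.R₀.root i) (D.m i * r * D.c) D.x₀ ≠ 0 ∧
    (0 < affineFn (D.R₀.root i) (D.m i * r * D.c) D.x₀ → 1 ≤ r ∨ (r = 0 ∧ D.base.IsPos i)) := by
  by_cases h : 1 ≤ r ∨ (r = 0 ∧ D.base.IsPos i)
  · exact ⟨(D.affineFn_pos h).ne', fun _ => h⟩
  · have h1 : 1 ≤ -r ∨ (-r = 0 ∧ D.base.IsPos (D.neg i)) := by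
      rw [isPos_neg_iff]
      by_cases hi : D.base.IsPos i <;> simp only [hi] at h ⊢ <;> grind
    have h2 := D.affineFn_pos h1
    rw [affineFn_apply, root_neg, inner_neg_left, m_neg] at h2
    rw [affineFn_apply]
    push_cast at h2
    exact ⟨by intro; linarith, fun _ => by linarith⟩

lemma ne_zero_x₀ {f : V →ᵃ[ℝ] ℝ} (hf : f ∈ D.affineRoots) : f D.x₀ ≠ 0 := by
  obtain ⟨i, r, rfl⟩ := hf
  exact (D.affineFn_x₀_ne_zero i r).1

lemma ne_zero_W {f : V →ᵃ[ℝ] ℝ} (hf : f ∈ D.affineRoots) (w : D.W) :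
    f ((w : V ≃ᵃ[ℝ] V) D.x₀) ≠ 0 := by
  have := D.ne_zero_x₀ (D.actFn_mem w⁻¹ hf)
  rwa [actFn_apply, inv_inv] at this

lemma a_pos_x₀ (j : D.I) : 0 < D.a j D.x₀ := by
  cases j with
  | none =>
    have := D.affineFn_pos (i := D.gradIdx none) (r := 1) (Or.inl le_rfl)
    simpa [a, α, const, m_gradIdx_zero] using this
  | some j =>
    simpa [a, α, const, gradIdx] using D.dominant_x₀ j.1 j.2

/-- `a_j` is the only positive affine root made negative by `s_j`. -/
lemma eq_a_of_pos_of_neg {f : V →ᵃ[ℝ] ℝ} (hf : f ∈ D.affineRoots) (h0 : 0 < f D.x₀) {j : D.I}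
    (hj : f ((D.s j : V ≃ᵃ[ℝ] V) D.x₀) < 0) : f = D.a j := by
  obtain ⟨i, r, rfl⟩ := hf
  have h1 := (D.affineFn_x₀_ne_zero i r).2 h0
  have hc : affineFn (D.R₀.root i) (D.m i * r * D.c) ((D.s j : V ≃ᵃ[ℝ] V) D.x₀) =
      affineFn (D.R₀.root i) (D.m i * r * D.c) D.x₀ -
        D.a j D.x₀ * D.cartan i (D.gradIdx j) := by
    simp only [s_apply, affineFn_apply, inner_sub_right, real_inner_smul_right, cartan_cast]
    ring
  cases j with
  | none =>
    have ha : D.a none D.x₀ = D.c - ⟪D.R₀.root D.θ, D.x₀⟫ := by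
      simp [a, const, affineFn_apply, α_zero]; ring
    have hapos := D.a_pos_x₀ none
    have hg : D.cartan i (D.gradIdx none) = -D.cartan i D.θ := D.cartan_neg_right i D.θ
    rw [hc, hg, ha] at hj
    rw [ha] at hapos
    push_cast at hj
    have ht : D.cartan i D.θ < 0 := by
      by_contra! h
      have : (0 : ℝ) ≤ D.cartan i D.θ := by exact_mod_cast h
      nlinarith [mul_nonneg hapos.le this]
    have hpos : D.base.IsPos (D.neg i) := D.isPos_of_cartan_θ_pos (by rw [cartan_neg_left]; lia)
    have hr : 1 ≤ r := by
      refine h1.resolve_right fun h => ?_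
      rw [isPos_neg_iff] at hpos
      exact hpos h.2
    have hr' : (1 : ℝ) ≤ r := by exact_mod_cast hr
    by_cases hi : D.neg i = D.θ
    · have hroot : D.R₀.root i = -D.R₀.root D.θ := by rw [← hi, root_neg, neg_neg]
      have hm : D.m i = 1 := by
        rw [← D.m_gradIdx_zero]
        exact D.m_eq_of_inner_eq (by simp [gradIdx, hroot])
      have hcar : D.cartan i D.θ = -2 := by
        have := D.cartan_neg_left i D.θ
        rw [hi, cartan, RootPairing.pairingIn_same] at this
        lia
      obtain rfl | h2 := hr.eq_or_lt
      · ext x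
        simp [a, const, α_zero, hroot, hm]
      · exfalso
        -- For f = -θ + r c one has f(s_0 x₀) = θ(x₀) + (r - 2) c, which is positive once r ≥ 2.
        have h2' : (2 : ℝ) ≤ r := by exact_mod_cast h2
        rw [hcar, affineFn_apply, hroot, inner_neg_left, hm] at hj
        push_cast at hj
        have := D.dominant_x₀.pos D.isPos_θ
        nlinarith [D.c_pos]
    -- For -α ≠ θ one has f(s_0 x₀) = (s_θ α)(x₀) + (m_α r + ⟨α, θ^∨⟩) c. The first term is positive
    -- by `h3`, and the second is at least m_α (r - 1) c ≥ 0 by `h2`.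
    · exfalso
      have h2 := D.cartan_θ_le_m hi
      rw [cartan_neg_left, m_neg] at h2
      push_cast at h2
      have h3 : D.base.IsPos (D.R₀.reflectionPerm D.θ i) := by
        refine D.isPos_of_cartan_θ_pos ?_
        have h5 := D.cartan_neg_right i D.θ
        rw [neg, cartan, D.R₀.pairingIn_reflectionPerm] at h5
        rw [cartan, h5]
        lia
      have h4 := D.dominant_x₀.pos h3
      rw [reflection_root, inner_sub_left, real_inner_smul_left] at h4
      rw [affineFn_apply] at hj
      nlinarith [D.c_pos, D.m_pos i, mul_nonneg (mul_nonneg (D.m_pos i).le (sub_nonneg.2 hr'))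
        D.c_pos.le]
  | some j =>
    have ha : D.a (some j) D.x₀ = ⟪D.R₀.root j, D.x₀⟫ := by
      simp [a, const, α, gradIdx]
    have hj2 : affineFn (D.R₀.root (D.R₀.reflectionPerm j i))
        (D.m (D.R₀.reflectionPerm j i) * r * D.c) D.x₀ < 0 := by
      rw [hc, ha] at hj
      rw [affineFn_apply] at hj ⊢
      rw [reflection_root, D.m_eq_of_inner_eq (D.inner_reflection i j i), inner_sub_left,
        real_inner_smul_left]
      simp only [gradIdx] at hj
      linarith
    obtain h2 | ⟨rfl, h2⟩ := h1
    · exact absurd (D.affineFn_pos (i := D.R₀.reflectionPerm j i) (Or.inl h2)) (by linarith)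
    · by_cases hij : i = j
      · subst hij
        simp [a, α, const, gradIdx]
      · exact absurd (D.affineFn_pos (Or.inr ⟨rfl, h2.reflectionPerm j.2 hij⟩)) (by linarith)

/-- The positive affine roots made negative by `w⁻¹`. -/
def inversions (w : D.W) : Set (V →ᵃ[ℝ] ℝ) :=
  {f | f ∈ D.affineRoots ∧ 0 < f D.x₀ ∧ f ((w : V ≃ᵃ[ℝ] V) D.x₀) < 0}

lemma finite_inversions (w : D.W) : (D.inversions w).Finite := by
  set y := (w : V ≃ᵃ[ℝ] V) D.x₀
  obtain ⟨N, hN⟩ := exists_nat_gt ((∑ i, |⟪D.R₀.root i, y⟫|) / D.c)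
  refine ((Set.finite_univ (α := ι)).prod (Set.finite_Icc (0 : ℤ) N)).image
    (fun p => affineFn (D.R₀.root p.1) (D.m p.1 * p.2 * D.c)) |>.subset ?_
  rintro _ ⟨⟨i, r, rfl⟩, h1, h2⟩
  have h3 := (D.affineFn_x₀_ne_zero i r).2 h1
  have hr : 0 ≤ r := by lia
  refine ⟨(i, r), ⟨Set.mem_univ _, hr, ?_⟩, rfl⟩
  rw [affineFn_apply] at h2
  have h4 := Finset.single_le_sum (f := fun i => |⟪D.R₀.root i, y⟫|) (fun _ _ => abs_nonneg _)
    (Finset.mem_univ i)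
  rw [div_lt_iff₀ D.c_pos] at hN
  have h5 := neg_abs_le ⟪D.R₀.root i, y⟫
  have hr' : (0 : ℝ) ≤ r := by exact_mod_cast hr
  have h6 : (r : ℝ) * D.c < N * D.c := by
    nlinarith [mul_nonneg (sub_nonneg.2 (D.one_le_m i)) (mul_nonneg hr' D.c_pos.le)]
  exact_mod_cast (lt_of_mul_lt_mul_right h6 D.c_pos.le).le

/-- The length of an element of the extended affine Weyl group. -/
def length (w : D.W) : ℕ := (D.inversions w).ncard

lemma inv_s (j : D.I) : (D.s j)⁻¹ = D.s j := inv_eq_of_mul_eq_one_right (D.s_mul_self j)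

lemma actFn_s_apply (j : D.I) (f : V →ᵃ[ℝ] ℝ) (x : V) :
    actFn (D.s j : V ≃ᵃ[ℝ] V) f x = f ((D.s j : V ≃ᵃ[ℝ] V) x) := by
  rw [actFn_apply, inv_s]

lemma actFn_s_s (j : D.I) (f : V →ᵃ[ℝ] ℝ) :
    actFn (D.s j : V ≃ᵃ[ℝ] V) (actFn (D.s j : V ≃ᵃ[ℝ] V) f) = f := by
  ext x; rw [actFn_s_apply, actFn_s_apply, s_s_apply]

/-- As s_j permutes the positive affine roots other than a_j, the inversions of s_j w are a_j and
the images under s_j of the inversions of w. -/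
lemma length_s_mul_of_pos {w : D.W} {j : D.I} (h : 0 < D.a j ((w : V ≃ᵃ[ℝ] V) D.x₀)) :
    D.length (D.s j * w) = D.length w + 1 := by
  have hpos : ∀ f ∈ D.affineRoots, f ≠ D.a j → 0 < f D.x₀ →
      0 < f ((D.s j : V ≃ᵃ[ℝ] V) D.x₀) := fun f hf hne h0 =>
    lt_of_le_of_ne (not_lt.1 fun h1 => hne (D.eq_a_of_pos_of_neg hf h0 h1)) (D.ne_zero_W hf _).symm
  have hinv : D.inversions (D.s j * w) =
      insert (D.a j) (actFn (D.s j : V ≃ᵃ[ℝ] V) '' D.inversions w) := by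
    ext f
    constructor
    · rintro ⟨hf, h0, h1⟩
      by_cases hfj : f = D.a j
      · exact Or.inl hfj
      · refine Or.inr ⟨actFn (D.s j : V ≃ᵃ[ℝ] V) f, ⟨D.actFn_mem _ hf, ?_, ?_⟩, D.actFn_s_s j f⟩
        · rw [actFn_s_apply]; exact hpos f hf hfj h0
        · rw [actFn_s_apply]; exact h1
    · rintro (rfl | ⟨g, ⟨hg, h0, h1⟩, rfl⟩)
      · refine ⟨D.a_mem j, D.a_pos_x₀ j, ?_⟩
        rw [coe_mul_apply, a_s_self]; linarith
      · refine ⟨D.actFn_mem _ hg, ?_, ?_⟩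
        · rw [actFn_s_apply]
          exact hpos g hg (by rintro rfl; linarith) h0
        · rw [actFn_s_apply, coe_mul_apply, s_s_apply]; exact h1
  have hinj : Function.Injective (actFn (D.s j : V ≃ᵃ[ℝ] V)) :=
    Function.LeftInverse.injective (D.actFn_s_s j)
  rw [length, hinv, Set.ncard_insert_of_notMem _ ((D.finite_inversions w).image _),
    Set.ncard_image_of_injective _ hinj, length]
  rintro ⟨g, ⟨_, h0, _⟩, hgj⟩
  have := D.a_pos_x₀ j
  rw [← D.actFn_s_s j g, hgj, actFn_s_apply, a_s_self] at h0
  linarith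

lemma length_s_mul_of_neg {w : D.W} {j : D.I} (h : D.a j ((w : V ≃ᵃ[ℝ] V) D.x₀) < 0) :
    D.length w = D.length (D.s j * w) + 1 := by
  have := D.length_s_mul_of_pos (w := D.s j * w) (j := j) (by
    rw [coe_mul_apply, a_s_self]; linarith)
  rwa [s_mul_s_mul] at this

lemma length_s_mul_le (w : D.W) (j : D.I) : D.length (D.s j * w) ≤ D.length w + 1 := by
  rcases lt_or_gt_of_ne (D.ne_zero_W (D.a_mem j) w) with h | h
  · have := D.length_s_mul_of_neg h
    lia
  · exact (D.length_s_mul_of_pos h).le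

/-- If all a_j are positive at y = w x₀, then y is dominant with θ(y) < c, and the bound α ≤ m_α θ
makes every positive affine root positive at y. -/
lemma exists_descent {w : D.W} {f : V →ᵃ[ℝ] ℝ} (hf : f ∈ D.inversions w) :
    ∃ j, D.a j ((w : V ≃ᵃ[ℝ] V) D.x₀) < 0 := by
  by_contra! hcon
  obtain ⟨⟨i, r, rfl⟩, h0, h1⟩ := hf
  set y := (w : V ≃ᵃ[ℝ] V) D.x₀
  have hy : ∀ j, 0 < D.a j y := fun j =>
    lt_of_le_of_ne (hcon j) (D.ne_zero_W (D.a_mem j) w).symm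
  have hdom : D.Dominant y := fun j hj => by
    simpa [a, const, α, gradIdx] using hy (some ⟨j, hj⟩)
  have hθ : ⟪D.R₀.root D.θ, y⟫ < D.c := by
    have := hy none
    simp only [a, const, α_zero, affineFn_apply, inner_neg_left] at this
    linarith
  have hm := D.m_pos i
  rw [affineFn_apply] at h1
  obtain hr | ⟨rfl, hi⟩ := (D.affineFn_x₀_ne_zero i r).2 h0
  · have h2 := hdom.le_θ (D.neg i)
    rw [root_neg, inner_neg_left, m_neg] at h2
    have hr' : (1 : ℝ) ≤ r := by exact_mod_cast hr
    nlinarith [D.c_pos, mul_pos hm D.c_pos, mul_pos hm (sub_pos.2 hθ),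
      mul_nonneg (sub_nonneg.2 hr') (mul_pos hm D.c_pos).le]
  · have := hdom.pos hi
    simp only [Int.cast_zero, mul_zero, zero_mul, add_zero] at h1
    linarith

lemma gradIdx_injective : Function.Injective D.gradIdx := by
  have h : ∀ j : D.base.support, D.gradIdx none ≠ D.gradIdx (some j) := by
    intro j hj
    have h1 : ¬ D.base.IsPos (D.gradIdx none) := by
      have := D.isPos_neg_iff (D.gradIdx none)
      rw [← D.isPos_neg_iff]
      have h2 : D.neg (D.gradIdx none) = D.θ :=
        D.R₀.root.injective (by rw [root_neg]; change -D.α none = _; rw [α_zero, neg_neg])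
      rw [h2]; exact D.isPos_θ
    rw [hj] at h1
    exact h1 (RootPairing.Base.isPos_of_mem_support j.2)
  rintro (_ | j) (_ | k) hjk
  · rfl
  · exact absurd hjk (h k)
  · exact absurd hjk.symm (h j)
  · exact congrArg some (Subtype.ext hjk)

lemma a_injective : Function.Injective D.a := by
  intro j k h
  refine D.gradIdx_injective (D.R₀.root.injective ?_)
  have h1 : ∀ x, ⟪D.α j - D.α k, x⟫ = 0 := fun x => by
    have h2 := congrArg (· x) h
    have h3 := congrArg (· 0) h
    simp only [a, affineFn_apply, inner_zero_right] at h2 h3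
    rw [inner_sub_left]; linarith
  exact sub_eq_zero.1 (inner_self_eq_zero.1 (h1 _))

/-- The elements without descents permute the simple affine roots. -/
lemma mem_Ω_of_forall_pos {w : D.W} (h : ∀ j, 0 < D.a j ((w : V ≃ᵃ[ℝ] V) D.x₀)) : w ∈ D.Ω := by
  have hw : ∀ f ∈ D.affineRoots, 0 < f D.x₀ → 0 < f ((w : V ≃ᵃ[ℝ] V) D.x₀) := by
    intro f hf h0
    refine lt_of_le_of_ne (not_lt.1 fun h1 => ?_) (D.ne_zero_W hf w).symm
    obtain ⟨j, hj⟩ := D.exists_descent ⟨hf, h0, h1⟩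
    exact absurd hj (h j).not_gt
  have hw' : ∀ f ∈ D.affineRoots, f ((w : V ≃ᵃ[ℝ] V) D.x₀) < 0 → f D.x₀ < 0 := by
    intro f hf h1
    refine lt_of_le_of_ne (not_lt.1 fun h0 => ?_) (D.ne_zero_x₀ hf)
    exact absurd (hw f hf h0) h1.not_gt
  have hwi : ∀ f ∈ D.affineRoots, 0 < f D.x₀ →
      0 < f (((w⁻¹ : D.W) : V ≃ᵃ[ℝ] V) D.x₀) := by
    intro f hf h0
    refine lt_of_le_of_ne (not_lt.1 fun h1 => ?_) (D.ne_zero_W hf w⁻¹).symm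
    have h2 := hw _ (D.neg_mem_affineRoots (D.actFn_mem w hf)) (by
      change 0 < -(actFn (w : V ≃ᵃ[ℝ] V) f D.x₀)
      rw [actFn_apply]; linarith)
    change 0 < -(actFn (w : V ≃ᵃ[ℝ] V) f _) at h2
    rw [actFn_apply, ← coe_mul_apply, inv_mul_cancel] at h2
    change 0 < -(f D.x₀) at h2
    linarith
  have key : ∀ j, ∃ k, actFn (w : V ≃ᵃ[ℝ] V) (D.a j) = D.a k := by
    intro j
    -- The root β = w a_j is positive, and its reflection w s_j w⁻¹ sends it to -β. The resulting
    -- descent k of this reflection is the required index.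
    have hβ : actFn (w : V ≃ᵃ[ℝ] V) (D.a j) ∈ D.inversions (w * D.s j * w⁻¹) := by
      refine ⟨D.actFn_mem w (D.a_mem j), ?_, ?_⟩
      · rw [actFn_apply]; exact hwi _ (D.a_mem j) (D.a_pos_x₀ j)
      · rw [actFn_apply, ← coe_mul_apply, ← mul_assoc, ← mul_assoc, inv_mul_cancel, one_mul,
          coe_mul_apply, a_s_self]
        linarith [hwi _ (D.a_mem j) (D.a_pos_x₀ j)]
    obtain ⟨k, hk⟩ := D.exists_descent hβ
    refine ⟨k, ?_⟩
    -- The root w⁻¹ a_k is positive and becomes negative under s_j, and only a_j has this property.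
    have hγ : actFn ((w⁻¹ : D.W) : V ≃ᵃ[ℝ] V) (D.a k) = D.a j := by
      refine D.eq_a_of_pos_of_neg (D.actFn_mem _ (D.a_mem k)) ?_ ?_
      · rw [actFn_apply, inv_inv]; exact h k
      · have h2 : actFn ((D.s j * w⁻¹ : D.W) : V ≃ᵃ[ℝ] V) (D.a k) D.x₀ < 0 := by
          by_contra! hcon
          have h3 := hwi _ (D.actFn_mem (D.s j * w⁻¹) (D.a_mem k))
            (lt_of_le_of_ne hcon (D.ne_zero_x₀ (D.actFn_mem _ (D.a_mem k))).symm)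
          rw [actFn_apply, ← coe_mul_apply, mul_inv_rev, inv_inv, inv_s] at h3
          exact absurd hk h3.not_gt
        rw [actFn_apply, mul_inv_rev, inv_inv, inv_s, coe_mul_apply] at h2
        rwa [actFn_apply, inv_inv]
    rw [← hγ, ← actFn_mul, ← Subgroup.coe_mul, mul_inv_cancel]
    exact actFn_one _
  choose σ hσ using key
  have hinj : Function.Injective σ := by
    intro j k hjk
    have h1 : actFn (w : V ≃ᵃ[ℝ] V) (D.a j) = actFn (w : V ≃ᵃ[ℝ] V) (D.a k) := by
      rw [hσ, hσ, hjk]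
    have h2 := congrArg (actFn ((w⁻¹ : D.W) : V ≃ᵃ[ℝ] V)) h1
    simp only [← actFn_mul, ← Subgroup.coe_mul, inv_mul_cancel] at h2
    exact D.a_injective ((actFn_one _).symm.trans (h2.trans (actFn_one _)))
  exact ⟨Equiv.ofBijective σ (Finite.injective_iff_bijective.1 hinj), hσ⟩

lemma pos_of_mem_Ω (u : D.Ω) (j : D.I) : 0 < D.a j (((u : D.W) : V ≃ᵃ[ℝ] V) D.x₀) := by
  obtain ⟨σ, hσ⟩ := (u⁻¹).2
  have h := congrArg (· D.x₀) (hσ j)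
  simp only [Subgroup.coe_inv] at h
  have h2 : actFn (((u : D.W) : V ≃ᵃ[ℝ] V)⁻¹) (D.a j) D.x₀ =
    D.a j (((u : D.W) : V ≃ᵃ[ℝ] V) D.x₀) := by simp [actFn]
  rw [← h2, h]
  exact D.a_pos_x₀ _

/-! ### Pairs of simple affine roots -/

lemma affineCartan_nonpos {j k : D.I} (h : j ≠ k) : D.affineCartan j k ≤ 0 := by
  rcases j with _ | j <;> rcases k with _ | k
  · exact absurd rfl h
  · have h1 := D.cartan_neg_left D.θ k
    have h2 := D.cartan_θ_nonneg k.2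
    change D.cartan (D.neg D.θ) k ≤ 0
    lia
  · have h1 := D.cartan_neg_right j D.θ
    have h2 : 0 ≤ D.cartan j D.θ := by
      have h3 := D.cartan_θ_nonneg j.2
      by_contra! h4
      have h5 := D.inner_root_nonneg_of_cartan h3
      have h6 := D.cartan_mul j D.θ
      have h7 : (D.cartan j D.θ : ℝ) < 0 := by exact_mod_cast h4
      rw [real_inner_comm] at h5
      nlinarith [D.root_inner_pos D.θ]
    change D.cartan j (D.neg D.θ) ≤ 0
    lia
  · exact RootPairing.Base.pairingIn_le_zero_of_ne D.base
      (fun h' => h (congrArg some (Subtype.ext h'))) j.2 k.2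

/-- Crystallographic and reduced root systems exclude products above 4 and the pairs (-1, -4), (-4,
-1). The last case, (-2, -2), means α_k = -α_j, as in rank one. -/
lemma affineCartan_cases {j k : D.I} (h : j ≠ k) :
    (D.affineCartan j k = 0 ∧ D.affineCartan k j = 0) ∨
    (D.affineCartan j k = -1 ∧ D.affineCartan k j = -1) ∨
    (D.affineCartan j k = -1 ∧ D.affineCartan k j = -2) ∨
    (D.affineCartan j k = -2 ∧ D.affineCartan k j = -1) ∨
    (D.affineCartan j k = -1 ∧ D.affineCartan k j = -3) ∨
    (D.affineCartan j k = -3 ∧ D.affineCartan k j = -1) ∨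
    (D.affineCartan j k = -2 ∧ D.affineCartan k j = -2) := by
  have h1 := D.affineCartan_nonpos h
  have h2 := D.affineCartan_nonpos h.symm
  have h3 := D.R₀.pairingIn_pairingIn_mem_set_of_isCrystal_of_isRed (D.gradIdx j) (D.gradIdx k)
  simp only [Set.mem_insert_iff, Set.mem_singleton_iff, Prod.mk_zero_zero, Prod.mk_eq_zero,
    Prod.mk_one_one, Prod.mk_eq_one, Prod.mk.injEq] at h3
  unfold affineCartan cartan at *
  lia

lemma ext_W {w w' : D.W} (h : ∀ x, (w : V ≃ᵃ[ℝ] V) x = (w' : V ≃ᵃ[ℝ] V) x) : w = w' := by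
  ext x; exact h x

section
variable {D} {j k : D.I} {x : V}

lemma s_mul_comm_of_cartan (h1 : D.affineCartan j k = 0) (h2 : D.affineCartan k j = 0) :
    D.s j * D.s k = D.s k * D.s j := by
  refine D.ext_W fun x => ?_
  simp only [coe_mul_apply, s_apply, a_sub_smul_coroot, h1, h2]
  push_cast
  module

lemma s_braid_three (h1 : D.affineCartan j k = -1) (h2 : D.affineCartan k j = -1) :
    D.s j * (D.s k * D.s j) = D.s k * (D.s j * D.s k) := by
  refine D.ext_W fun x => ?_
  simp only [coe_mul_apply, s_apply, a_sub_smul_coroot, h1, h2]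
  push_cast [affineCartan, cartan, RootPairing.pairingIn_same]
  module

lemma s_braid_four (h1 : D.affineCartan j k = -1) (h2 : D.affineCartan k j = -2) :
    D.s j * (D.s k * (D.s j * D.s k)) = D.s k * (D.s j * (D.s k * D.s j)) := by
  refine D.ext_W fun x => ?_
  simp only [coe_mul_apply, s_apply, a_sub_smul_coroot, h1, h2]
  push_cast [affineCartan, cartan, RootPairing.pairingIn_same]
  module

lemma s_braid_six (h1 : D.affineCartan j k = -1) (h2 : D.affineCartan k j = -3) :
    D.s j * (D.s k * (D.s j * (D.s k * (D.s j * D.s k)))) =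
      D.s k * (D.s j * (D.s k * (D.s j * (D.s k * D.s j)))) := by
  refine D.ext_W fun x => ?_
  simp only [coe_mul_apply, s_apply, a_sub_smul_coroot, h1, h2]
  push_cast [affineCartan, cartan, RootPairing.pairingIn_same]
  module

/-- Used to bound the orders of s_j s_k from below: the relevant powers move x₀ to the negative side
of a wall. -/
lemma ne_one_of_neg {w : D.W} (h : D.a j ((w : V ≃ᵃ[ℝ] V) D.x₀) < 0) : w ≠ 1 := by
  rintro rfl
  exact absurd h (D.a_pos_x₀ j).not_gt

lemma coxeterM_comm (j k : D.I) : D.coxeterM j k = D.coxeterM k j := by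
  unfold coxeterM
  rw [← orderOf_inv, mul_inv_rev, inv_s, inv_s]

lemma coxeterM_eq_two (h1 : D.affineCartan j k = 0) (h2 : D.affineCartan k j = 0) :
    D.coxeterM j k = 2 := by
  refine orderOf_eq_prime ?_ (ne_one_of_neg (j := j) ?_)
  · rw [pow_two, mul_assoc, ← mul_assoc (D.s k), s_mul_comm_of_cartan h2 h1]
    simp [mul_assoc]
  · have := D.a_pos_x₀ j
    rw [coe_mul_apply, a_s_self, a_s, h1]
    simpa

lemma coxeterM_eq_three (h1 : D.affineCartan j k = -1) (h2 : D.affineCartan k j = -1) :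
    D.coxeterM j k = 3 := by
  refine orderOf_eq_prime ?_ (ne_one_of_neg (j := j) ?_)
  · simp only [pow_succ, pow_zero, one_mul, mul_assoc]
    rw [s_braid_three h2 h1]
    simp
  · have := D.a_pos_x₀ j
    have := D.a_pos_x₀ k
    rw [coe_mul_apply, a_s_self, a_s, h1]
    push_cast
    linarith

lemma coxeterM_eq_four (h1 : D.affineCartan j k = -1) (h2 : D.affineCartan k j = -2) :
    D.coxeterM j k = 4 := by
  refine orderOf_eq_prime_pow (p := 2) (n := 1) (ne_one_of_neg (j := j) ?_) ?_
  · have := D.a_pos_x₀ j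
    have := D.a_pos_x₀ k
    simp only [pow_succ, pow_zero, one_mul, mul_assoc, coe_mul_apply, a_s_self, a_s, h1, h2]
    push_cast
    linarith
  · change _ ^ 4 = _
    simp only [pow_succ, pow_zero, one_mul, mul_assoc, s_braid_four h1 h2, s_mul_s_mul, s_mul_self,
      mul_one]

lemma coxeterM_eq_six (h1 : D.affineCartan j k = -1) (h2 : D.affineCartan k j = -3) :
    D.coxeterM j k = 6 := by
  have := D.a_pos_x₀ j
  have := D.a_pos_x₀ k
  refine orderOf_eq_of_pow_and_pow_div_prime (by norm_num) ?_ ?_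
  · simp only [pow_succ, pow_zero, one_mul, mul_assoc, s_braid_six h1 h2, s_mul_s_mul, s_mul_self,
      mul_one]
  · intro p hp hp6
    have hp' : p = 2 ∨ p = 3 := by
      have : p ∣ 2 * 3 := hp6
      rcases hp.dvd_mul.1 this with h | h
      · exact Or.inl ((Nat.prime_dvd_prime_iff_eq hp Nat.prime_two).1 h)
      · exact Or.inr ((Nat.prime_dvd_prime_iff_eq hp Nat.prime_three).1 h)
    refine ne_one_of_neg (j := j) ?_
    rcases hp' with rfl | rfl <;> norm_num only <;>
    simp only [pow_succ, pow_zero, one_mul, mul_assoc, coe_mul_apply, a_s_self, a_s, h1, h2] <;>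
    push_cast <;> linarith

/-- Here s_j s_k preserves a_j + a_k, and each application lowers a_j by twice that positive
constant along the orbit of x₀, so no positive power is trivial. -/
lemma coxeterM_eq_zero (h1 : D.affineCartan j k = -2) (h2 : D.affineCartan k j = -2) :
    D.coxeterM j k = 0 := by
  have hj := D.a_pos_x₀ j
  have hk := D.a_pos_x₀ k
  have key : ∀ n : ℕ,
      D.a j ((((D.s j * D.s k) ^ n : D.W) : V ≃ᵃ[ℝ] V) D.x₀) =
        D.a j D.x₀ - 2 * n * (D.a j D.x₀ + D.a k D.x₀) ∧
      D.a j ((((D.s j * D.s k) ^ n : D.W) : V ≃ᵃ[ℝ] V) D.x₀) +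
        D.a k ((((D.s j * D.s k) ^ n : D.W) : V ≃ᵃ[ℝ] V) D.x₀) = D.a j D.x₀ + D.a k D.x₀ := by
    intro n
    induction n with
    | zero => simp
    | succ n ih =>
      rw [pow_succ', mul_assoc]
      simp only [coe_mul_apply, a_s_self, a_s, h1, h2, Int.cast_neg, Int.cast_ofNat, Nat.cast_add,
        Nat.cast_one]
      constructor <;> linarith
  refine orderOf_eq_zero_iff'.2 fun n hn => ne_one_of_neg (j := j) ?_
  have hn' : (1 : ℝ) ≤ n := by exact_mod_cast hn
  rw [(key n).1]
  nlinarith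

end

/-- The first `n` steps of the alternating sequence `w, s_j w, s_k s_j w, …` are descents. -/
def AltDescents : ℕ → D.I → D.I → D.W → Prop
  | 0, _, _, _ => True
  | n + 1, j, k, w => D.a j ((w : V ≃ᵃ[ℝ] V) D.x₀) < 0 ∧ AltDescents n k j (D.s j * w)

lemma AltDescents.le_length {D : AffineRootData ι V} {n : ℕ} {j k : D.I} {w : D.W}
    (h : D.AltDescents n j k w) : n ≤ D.length w := by
  induction n generalizing j k w with
  | zero => exact Nat.zero_le _
  | succ n ih => rw [D.length_s_mul_of_neg h.1]; exact Nat.succ_le_succ (ih h.2)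

/-- The sum a_j + a_k is invariant under both reflections; if it is negative, descents continue
forever. -/
lemma altDescents_of_neg_two {D : AffineRootData ι V} {j k : D.I}
    (h1 : D.affineCartan j k = -2) (h2 : D.affineCartan k j = -2) (n : ℕ) {w : D.W}
    (hj : D.a j ((w : V ≃ᵃ[ℝ] V) D.x₀) < 0)
    (hk : D.a j ((w : V ≃ᵃ[ℝ] V) D.x₀) + D.a k ((w : V ≃ᵃ[ℝ] V) D.x₀) < 0) :
    D.AltDescents n j k w := by
  induction n generalizing j k w with
  | zero => trivial
  | succ n ih =>
    refine ⟨hj, ih h2 h1 ?_ ?_⟩ <;> simp only [coe_mul_apply, a_s_self, a_s, h2] <;> push_cast <;>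
      linarith

/-- Two descents `s_j`, `s_k` of `w` generate a finite group, and `w` starts with its longest
element. -/
lemma altDescents_coxeterM {j k : D.I} (h : j ≠ k) {w : D.W}
    (hj : D.a j ((w : V ≃ᵃ[ℝ] V) D.x₀) < 0) (hk : D.a k ((w : V ≃ᵃ[ℝ] V) D.x₀) < 0) :
    1 ≤ D.coxeterM j k ∧ D.AltDescents (D.coxeterM j k) j k w := by
  rcases D.affineCartan_cases h with
    ⟨h1, h2⟩ | ⟨h1, h2⟩ | ⟨h1, h2⟩ | ⟨h1, h2⟩ | ⟨h1, h2⟩ | ⟨h1, h2⟩ | ⟨h1, h2⟩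
  · rw [coxeterM_eq_two h1 h2]
    refine ⟨by norm_num, ?_⟩
    simp only [AltDescents, coe_mul_apply, a_s, h2, and_true]
    push_cast
    refine ⟨?_, ?_⟩ <;> linarith
  · rw [coxeterM_eq_three h1 h2]
    refine ⟨by norm_num, ?_⟩
    simp only [AltDescents, coe_mul_apply, a_s_self, a_s, h1, h2, and_true]
    push_cast
    refine ⟨?_, ?_, ?_⟩ <;> linarith
  · rw [coxeterM_eq_four h1 h2]
    refine ⟨by norm_num, ?_⟩
    simp only [AltDescents, coe_mul_apply, a_s_self, a_s, h1, h2, and_true]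
    push_cast
    refine ⟨?_, ?_, ?_, ?_⟩ <;> linarith
  · rw [coxeterM_comm, coxeterM_eq_four h2 h1]
    refine ⟨by norm_num, ?_⟩
    simp only [AltDescents, coe_mul_apply, a_s_self, a_s, h1, h2, and_true]
    push_cast
    refine ⟨?_, ?_, ?_, ?_⟩ <;> linarith
  · rw [coxeterM_eq_six h1 h2]
    refine ⟨by norm_num, ?_⟩
    simp only [AltDescents, coe_mul_apply, a_s_self, a_s, h1, h2, and_true]
    push_cast
    refine ⟨?_, ?_, ?_, ?_, ?_, ?_⟩ <;> linarith
  · rw [coxeterM_comm, coxeterM_eq_six h2 h1]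
    refine ⟨by norm_num, ?_⟩
    simp only [AltDescents, coe_mul_apply, a_s_self, a_s, h1, h2, and_true]
    push_cast
    refine ⟨?_, ?_, ?_, ?_, ?_, ?_⟩ <;> linarith
  -- In the infinite dihedral case two simultaneous descents would give more alternating descents
  -- than the length of w allows.
  · have := (altDescents_of_neg_two h1 h2 (D.length w + 1) hj (by linarith)).le_length
    lia

end AffineRootData

/-! ### Demazure-Lusztig elements in a skew group algebra -/

section DemazureLusztig

open SkewMonoidAlgebra

variable {A G : Type*} [CommRing A] [Group G] [MulSemiringAction G A]

/-- The element `t s + a u (1 - s)` of a skew group algebra. -/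
def demazureLusztig (s : G) (t a u : A) : SkewMonoidAlgebra A G :=
  singleOneRingHom (a * u) + single s (t - a * u)

lemma single_mul_singleOneRingHom (w : G) (f g : A) :
    (single w f : SkewMonoidAlgebra A G) * singleOneRingHom g =
      singleOneRingHom (MulSemiringAction.toRingHom G A w g) * single w f := by
  change single w f * single 1 g = single 1 (w • g) * single w f
  rw [single_mul_single, single_mul_single]
  simp [mul_comm]

/-- Since s exchanges u and 1 - u, the square is (t - a u)(t - a (1 - u)), and t (t - a) = 1 removes
t from it. -/
lemma single_mul_self_of_smul {s : G} {t a u : A} (hs : s * s = 1) (ht : t * (t - a) = 1)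
    (hst : s • t = t) (hsa : s • a = a) (hsu : s • u = 1 - u) :
    (single s (t - a * u) : SkewMonoidAlgebra A G) * single s (t - a * u) =
      singleOneRingHom (1 + a ^ 2 * (u * (1 - u))) := by
  rw [single_mul_single, hs]
  refine congrArg (single 1) ?_
  rw [smul_sub, smul_mul', hst, hsa, hsu]
  linear_combination ht

lemma demazureLusztig_quadratic {s : G} {t t' a u : A} (hs : s * s = 1) (ha : t - a = t')
    (ht : t * t' = 1) (hst : s • t = t) (hsa : s • a = a) (hsu : s • u = 1 - u) :
    (demazureLusztig s t a u - singleOneRingHom t) *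
        (demazureLusztig s t a u + singleOneRingHom t') =
      0 := by
  subst ha
  have h1 := single_mul_self_of_smul hs ht hst hsa hsu
  have h2 : (single s (t - a * u) : SkewMonoidAlgebra A G) * singleOneRingHom (a * u + (t - a)) =
      singleOneRingHom (t - a * u) * single s (t - a * u) := by
    rw [single_mul_singleOneRingHom, MulSemiringAction.toRingHom_apply, smul_add, smul_mul',
      smul_sub, hst, hsa, hsu]
    congr 2
    ring
  have h3 : demazureLusztig s t a u - singleOneRingHom t =
      -singleOneRingHom (t - a * u) + single s (t - a * u) := by
    simp only [demazureLusztig, map_sub]; abel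
  have h4 : demazureLusztig s t a u + singleOneRingHom (t - a) =
      singleOneRingHom (a * u + (t - a)) + single s (t - a * u) := by
    simp only [demazureLusztig, map_add]; abel
  rw [h3, h4, add_mul, mul_add, mul_add, h1, h2, neg_mul, neg_mul, ← map_mul, add_comm (_ * _),
    add_assoc, add_comm, add_assoc, add_assoc, neg_add_cancel_left, add_neg_eq_zero]
  congr 1
  linear_combination -ht

lemma demazureLusztig_mul_singleOneRingHom (s : G) (t a u f : A) :
    demazureLusztig s t a u * singleOneRingHom f =
      singleOneRingHom (s • f) * demazureLusztig s t a u +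
        singleOneRingHom (a * (u * (f - s • f))) := by
  rw [demazureLusztig, add_mul, single_mul_singleOneRingHom, mul_add, ← map_mul, ← map_mul,
    MulSemiringAction.toRingHom_apply, add_right_comm, ← map_add]
  congr 2
  ring

variable {s r : G} {t t' a b u0 u1 u2 u3 u4 u5 : A}

lemma demazureLusztig_braid_two (hb : s * r = r * s) (ht : s • t' = t') (hb' : s • b = b)
    (h1 : s • u1 = u1) (hr : r • t = t) (ha : r • a = a) (h0 : r • u0 = u0) :
    altProd (demazureLusztig s t a u0) (demazureLusztig r t' b u1) 2 =
      altProd (demazureLusztig r t' b u1) (demazureLusztig s t a u0) 2 := by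
  refine braid_two (single_mul_singleOneRingHom _ _) (single_mul_singleOneRingHom _ _) ?_ ?_ ?_
  · simp only [single_mul_single, smul_sub, smul_mul', *, mul_comm (t - a * u0)]
  · simp only [MulSemiringAction.toRingHom_apply, smul_mul', *]
  · simp only [MulSemiringAction.toRingHom_apply, smul_mul', *]

lemma demazureLusztig_braid_three (hb : s * (r * s) = r * (s * r)) (hs : s * s = 1) (hr : r * r = 1)
    (ht : t * (t - a) = 1) (hst : s • t = t) (hrt : r • t = t) (hsa : s • a = a) (hra : r • a = a)
    (hs0 : s • u0 = 1 - u0) (hs1 : s • u1 = u2) (hs2 : s • u2 = u1)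
    (hr0 : r • u0 = u2) (hr1 : r • u1 = 1 - u1) (hr2 : r • u2 = u0)
    (h1 : u0 * u1 = u2 * (u0 + u1 - 1)) :
    altProd (demazureLusztig s t a u0) (demazureLusztig r t a u1) 3 =
      altProd (demazureLusztig r t a u1) (demazureLusztig s t a u0) 3 := by
  refine braid_three (u2 := u2) (single_mul_singleOneRingHom _ _) (single_mul_singleOneRingHom _ _)
    (single_mul_self_of_smul hs ht hst hsa hs0) (single_mul_self_of_smul hr ht hrt hra hr1)
    ?_ hsa hs0 hs1 hs2 hra hr0 hr1 hr2 h1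
  -- The braid relation for the monomial elements: both sides carry the same group element, with the
  -- factors t - a u over all positive roots as coefficient.
  simp only [single_mul_single, smul_sub, smul_mul', *]
  ring_nf

lemma demazureLusztig_braid_four (hb : s * (r * (s * r)) = r * (s * (r * s)))
    (hs : s * s = 1) (hr : r * r = 1) (ht : t * (t - a) = 1) (ht' : t' * (t' - b) = 1)
    (hst : s • t = t) (hst' : s • t' = t') (hrt : r • t = t) (hrt' : r • t' = t')
    (hsa : s • a = a) (hsb : s • b = b) (hra : r • a = a) (hrb : r • b = b)
    (hs0 : s • u0 = 1 - u0) (hs1 : s • u1 = u3) (hs2 : s • u2 = u2) (hs3 : s • u3 = u1)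
    (hr0 : r • u0 = u2) (hr1 : r • u1 = 1 - u1) (hr2 : r • u2 = u0) (hr3 : r • u3 = u3)
    (h1 : u0 * u1 = u2 * (u0 + u1 - 1)) (h2 : u0 * u2 = u3 * (u0 + u2 - 1)) :
    altProd (demazureLusztig s t a u0) (demazureLusztig r t' b u1) 4 =
      altProd (demazureLusztig r t' b u1) (demazureLusztig s t a u0) 4 := by
  refine braid_four (u2 := u2) (u3 := u3) (single_mul_singleOneRingHom _ _)
    (single_mul_singleOneRingHom _ _) (single_mul_self_of_smul hs ht hst hsa hs0)
    (single_mul_self_of_smul hr ht' hrt' hrb hr1)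
    ?_ hsa hsb hs0 hs1 hs2 hs3 hra hrb hr0 hr1 hr2 hr3 h1 h2
  simp only [single_mul_single, smul_sub, smul_mul', *]
  refine congrArg (single _) ?_
  ring

lemma demazureLusztig_braid_six
    (hb : s * (r * (s * (r * (s * r)))) = r * (s * (r * (s * (r * s)))))
    (hs : s * s = 1) (hr : r * r = 1) (ht : t * (t - a) = 1) (ht' : t' * (t' - b) = 1)
    (hst : s • t = t) (hst' : s • t' = t') (hrt : r • t = t) (hrt' : r • t' = t')
    (hsa : s • a = a) (hsb : s • b = b) (hra : r • a = a) (hrb : r • b = b)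
    (hs0 : s • u0 = 1 - u0) (hs1 : s • u1 = u4) (hs2 : s • u2 = u3) (hs3 : s • u3 = u2)
    (hs4 : s • u4 = u1) (hs5 : s • u5 = u5)
    (hr0 : r • u0 = u2) (hr1 : r • u1 = 1 - u1) (hr2 : r • u2 = u0) (hr3 : r • u3 = u3)
    (hr4 : r • u4 = u5) (hr5 : r • u5 = u4)
    (h1 : u0 * u1 = u2 * (u0 + u1 - 1)) (h2 : u0 * u2 = u3 * (u0 + u2 - 1))
    (h3 : u0 * u3 = u4 * (u0 + u3 - 1)) (h4 : u4 * u1 = u5 * (u4 + u1 - 1))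
    (h5 : u2 * u3 = u5 * (u2 + u3 - 1)) :
    altProd (demazureLusztig s t a u0) (demazureLusztig r t' b u1) 6 =
      altProd (demazureLusztig r t' b u1) (demazureLusztig s t a u0) 6 := by
  refine braid_six (u2 := u2) (u3 := u3) (u4 := u4) (u5 := u5) (single_mul_singleOneRingHom _ _)
    (single_mul_singleOneRingHom _ _) (single_mul_self_of_smul hs ht hst hsa hs0)
    (single_mul_self_of_smul hr ht' hrt' hrb hr1)
    ?_ hsa hsb hs0 hs1 hs2 hs3 hs4 hs5 hra hrb hr0 hr1 hr2 hr3 hr4 hr5 h1 h2 h3 h4 h5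
  simp only [single_mul_single, smul_sub, smul_mul', *]
  refine congrArg (single _) ?_
  generalize t - a * u0 = f0, t' - b * u1 = f1, t - a * u2 = f2, t' - b * u3 = f3,
    t - a * u3 = f3', t' - b * u4 = f4, t' - b * u5 = f5
  ring

end DemazureLusztig

namespace AffineRootData

variable {ι V : Type*} [Fintype ι] [NormedAddCommGroup V] [InnerProductSpace ℝ V]
  (D : AffineRootData ι V)

/-! ### Computations in `𝒜 # W` -/

open SkewMonoidAlgebra (single)

instance : CommRing D.A := inferInstance
instance : Mul D.A := inferInstance
instance : Add D.A := inferInstance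
instance : Sub D.A := inferInstance
instance : SMul D.W D.A := inferInstance
instance : Mul D.Smash := inferInstance
instance : Add D.Smash := inferInstance

lemma exists_linear_eq (w : D.W) : ∃ v ∈ D.W₀, ∀ y, (w : V ≃ᵃ[ℝ] V).linear y = v y := by
  obtain ⟨_, v, hv, l, _, rfl⟩ := w
  exact ⟨v, hv, fun _ => rfl⟩

lemma apply_sub (w : D.W) (x y : V) :
    (w : V ≃ᵃ[ℝ] V) (x - y) = (w : V ≃ᵃ[ℝ] V) x - (w : V ≃ᵃ[ℝ] V).linear y := by
  have := (w : V ≃ᵃ[ℝ] V).map_vadd x (-y)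
  rw [vadd_eq_add, vadd_eq_add, map_neg] at this
  rw [sub_eq_neg_add, this, sub_eq_neg_add]

lemma linear_s (j : D.I) (y : V) :
    (D.s j : V ≃ᵃ[ℝ] V).linear y = y - ⟪y, D.R₀.coroot (D.gradIdx j)⟫ • D.α j :=
  D.reflection_eq _ _

lemma a_apply_of_actFn {w : D.W} {j k : D.I} (h : actFn (w : V ≃ᵃ[ℝ] V) (D.a j) = D.a k) (x : V) :
    D.a k ((w : V ≃ᵃ[ℝ] V) x) = D.a j x := by
  rw [← h, actFn_apply, ← coe_mul_apply, inv_mul_cancel]; rfl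

/-- The identity a_k ∘ w = a_j says ⟨α_k, w' y⟩ = ⟨α_j, y⟩ for all y; as w' is orthogonal, this
determines w' α_j. -/
lemma linear_α {w : D.W} {j k : D.I} (h : actFn (w : V ≃ᵃ[ℝ] V) (D.a j) = D.a k) :
    (w : V ≃ᵃ[ℝ] V).linear (D.α j) = D.α k := by
  obtain ⟨v, hv, hw⟩ := D.exists_linear_eq w
  have h1 : ∀ y, ⟪D.α k, v y⟫ = ⟪D.α j, y⟫ := fun y => by
    have h2 := D.a_apply_of_actFn h (0 - y)
    have h3 := D.a_apply_of_actFn h 0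
    rw [apply_sub, hw] at h2
    simp only [a, affineFn_apply, inner_sub_right, inner_zero_right] at h2 h3
    linarith
  rw [hw, ← sub_eq_zero, ← inner_self_eq_zero (𝕜 := ℝ)]
  have h4 : v (D.α j) - D.α k = v (D.α j - v⁻¹ (D.α k)) := by
    rw [map_sub, ← LinearEquiv.mul_apply v, mul_inv_cancel]; rfl
  nth_rewrite 2 [h4]
  rw [inner_sub_left, D.W₀_inner hv, h1, sub_self]

lemma mul_s_of_actFn {w : D.W} {j k : D.I} (h : actFn (w : V ≃ᵃ[ℝ] V) (D.a j) = D.a k) :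
    w * D.s j = D.s k * w := by
  refine D.ext_W fun x => ?_
  have h1 := D.linear_α h
  obtain ⟨v, hv, hw⟩ := D.exists_linear_eq w
  rw [coe_mul_apply, coe_mul_apply, s_apply, s_apply, D.a_apply_of_actFn h, apply_sub, map_smul,
    D.coroot_eq, D.coroot_eq, map_smul]
  unfold α at h1
  rw [h1, ← h1, hw, D.W₀_inner hv]

lemma τ_eq {i k : ι} {v : V ≃ₗ[ℝ] V} (hv : v ∈ D.W₀) (h : v (D.R₀.root i) = D.R₀.root k) :
    D.τ i = D.τ k := by
  have h1 : Quotient.mk D.orbitRel i = Quotient.mk D.orbitRel k := Quotient.sound ⟨v, hv, h⟩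
  unfold τ
  ext1
  simp only [h1]

lemma τs_eq_of_actFn {w : D.W} {j k : D.I} (h : actFn (w : V ≃ᵃ[ℝ] V) (D.a j) = D.a k) :
    D.τs j = D.τs k := by
  obtain ⟨v, hv, hw⟩ := D.exists_linear_eq w
  exact D.τ_eq hv ((hw _).symm.trans (D.linear_α h))

/-- The image of `X^l` in `𝒜`. -/
def xA (l : D.P) : D.A := algebraMap D.LP D.A (D.x l)

lemma xA_add (l l' : D.P) : D.xA (l + l') = D.xA l * D.xA l' := by
  unfold xA
  rw [← map_mul]
  simp [x, AddMonoidAlgebra.single_mul_single]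

lemma xA_zero : D.xA 0 = 1 := map_one _

lemma smul_xA (w : D.W) (l : D.P) : w • D.xA l = D.xA (D.lin w l) := by
  rw [xA, smul_algebraMap_LP, actLP_x]; rfl

lemma rootP_neg (i : ι) : D.rootP (D.neg i) = -D.rootP i := Subtype.ext (D.root_neg i)

lemma isUnit_one_sub_xA (i : ι) : IsUnit (1 - D.xA (-D.rootP i)) := by
  have h1 : IsUnit (algebraMap D.LP D.A D.δ) := IsLocalization.Away.algebraMap_isUnit D.δ
  have h2 : 1 - D.xA (-D.rootP i) = algebraMap D.LP D.A (1 - D.x (D.rootP (D.neg i))) := by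
    rw [map_sub, map_one, rootP_neg]; rfl
  rw [h2]
  exact isUnit_of_dvd_unit (map_dvd _ (Finset.dvd_prod_of_mem (fun i => 1 - D.x (D.rootP i))
    (Finset.mem_univ _))) h1

/-- The element `1 / (1 - X^{-α})` of `𝒜`. -/
def e (i : ι) : D.A := ↑((D.isUnit_one_sub_xA i).unit⁻¹)

lemma e_mul (i : ι) : D.e i * (1 - D.xA (-D.rootP i)) = 1 := (D.isUnit_one_sub_xA i).val_inv_mul

lemma eq_e {i : ι} {f : D.A} (h : f * (1 - D.xA (-D.rootP i)) = 1) : f = D.e i :=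
  (D.isUnit_one_sub_xA i).mul_right_cancel (h.trans (D.e_mul i).symm)

lemma smul_e {w : D.W} {i k : ι} (h : (w : V ≃ᵃ[ℝ] V).linear (D.R₀.root i) = D.R₀.root k) :
    w • D.e i = D.e k := by
  refine D.eq_e ?_
  have h1 : D.xA (-D.rootP k) = w • D.xA (-D.rootP i) := by
    rw [smul_xA]
    congr 1
    ext
    simp [rootP, h]
  rw [h1, ← smul_one w, ← smul_sub, ← smul_mul', e_mul]

lemma e_neg (i : ι) : D.e (D.neg i) = 1 - D.e i := by
  symm
  refine D.eq_e ?_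
  have h1 := D.e_mul i
  have h2 : D.xA (-D.rootP i) * D.xA (-D.rootP (D.neg i)) = 1 := by
    rw [← xA_add, rootP_neg, ← xA_zero]; congr 1; abel
  linear_combination D.xA (-D.rootP (D.neg i)) * h1 + D.e i * h2

/-- A consequence of X^{-(α+β)} = X^{-α} X^{-β}; it is an exponential form of the addition theorem
for coth and the source of all identities behind the braid relations. -/
lemma e_mul_e {i k l : ι} (h : D.R₀.root l = D.R₀.root i + D.R₀.root k) :
    D.e i * D.e k = D.e l * (D.e i + D.e k - 1) := by
  have h1 : D.xA (-D.rootP l) = D.xA (-D.rootP i) * D.xA (-D.rootP k) := by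
    rw [← xA_add]
    congr 1
    ext
    simp [rootP, h]
    abel
  have hi := D.e_mul i
  have hk := D.e_mul k
  have hl := D.e_mul l
  rw [h1] at hl
  linear_combination (-D.e i * D.e k) * hl + D.e l * D.e k * D.xA (-D.rootP k) * hi +
    D.e l * (D.e i - 1) * hk

/-- Works in coordinates p α_j + q α_k, so that the action on rank-two roots becomes arithmetic with
Cartan integers. -/
lemma s_smul_e {j k : D.I} {i i' : ι} {p q : ℝ} (hi : D.R₀.root i = p • D.α j + q • D.α k)
    (hi' : D.R₀.root i' = (-p - q * D.affineCartan k j) • D.α j + q • D.α k) :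
    D.s j • D.e i = D.e i' := by
  refine D.smul_e ?_
  have h1 : ⟪D.α k, D.R₀.coroot (D.gradIdx j)⟫ = D.affineCartan k j := (D.cartan_cast _ _).symm
  have h2 : ⟪D.α j, D.R₀.coroot (D.gradIdx j)⟫ = 2 := by
    refine (D.cartan_cast _ _).symm.trans ?_
    rw [cartan, RootPairing.pairingIn_same]; norm_num
  rw [hi, hi', linear_s, inner_add_left, real_inner_smul_left, real_inner_smul_left, h1, h2]
  module

lemma s_smul_e_self (j : D.I) : D.s j • D.e (D.gradIdx j) = 1 - D.e (D.gradIdx j) := by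
  rw [← e_neg]
  refine D.smul_e ?_
  have := D.reflection_root (D.gradIdx j) (D.gradIdx j)
  rw [linear_s, root_neg]
  have h2 : ⟪D.R₀.root (D.gradIdx j), D.R₀.coroot (D.gradIdx j)⟫ = 2 := by
    refine (D.cartan_cast _ _).symm.trans ?_
    rw [cartan, RootPairing.pairingIn_same]; norm_num
  rw [h2]
  unfold α
  module

lemma W_smul_algebraMap (w : D.W) (r : D.𝕃) :
    w • algebraMap D.𝕃 D.A r = algebraMap D.𝕃 D.A r := smul_algebraMap w r

/-- The image of `τ_j` in `𝒜`. -/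
def tA (j : D.I) : D.A := algebraMap D.𝕃 D.A (D.τs j : D.𝕃)

/-- The image of `τ_j - τ_j⁻¹` in `𝒜`. -/
def dA (j : D.I) : D.A := algebraMap D.𝕃 D.A ((D.τs j : D.𝕃) - (↑(D.τs j)⁻¹ : D.𝕃))

@[simp] lemma smul_tA (w : D.W) (j : D.I) : w • D.tA j = D.tA j := D.W_smul_algebraMap w _

@[simp] lemma smul_dA (w : D.W) (j : D.I) : w • D.dA j = D.dA j := D.W_smul_algebraMap w _

lemma tA_mul_sub (j : D.I) : D.tA j * (D.tA j - D.dA j) = 1 := by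
  unfold tA dA
  rw [← map_sub, ← map_mul, sub_sub_cancel, Units.mul_inv, map_one]

lemma e_mul_sub (j : D.I) {l : D.P} {q : D.LP}
    (hq : q * (1 - D.x (-D.αP j)) = D.x l - D.x (D.lin (D.s j) l)) :
    D.e (D.gradIdx j) * (D.xA l - D.s j • D.xA l) = algebraMap D.LP D.A q := by
  have h1 := congrArg (algebraMap D.LP D.A) hq
  rw [map_mul, map_sub, map_sub, map_one] at h1
  rw [smul_xA]
  change _ * (1 - D.xA (-D.rootP (D.gradIdx j))) = D.xA l - D.xA _ at h1
  rw [← h1, mul_left_comm, e_mul, mul_one]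

/-- `𝒜 → 𝒜 # W` as a ring homomorphism. -/
def ofARingHom : D.A →+* D.Smash := SkewMonoidAlgebra.singleOneRingHom

lemma ofARingHom_apply (f : D.A) : D.ofARingHom f = D.ofA f := rfl

lemma smul_eq_ofA_mul (r : D.𝕃) (z : D.Smash) : r • z = D.ofARingHom (algebraMap D.𝕃 D.A r) * z :=
  Algebra.smul_def r z

lemma single_eq (w : D.W) (f : D.A) : (single w f : D.Smash) = D.ofARingHom f * D.ofW w := by
  change _ = single 1 f * single w 1
  rw [SkewMonoidAlgebra.single_mul_single]
  simp

/-- Collects the terms as (element of 𝒜) + (element of 𝒜) s_j, the shape in which the rank-two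
computations apply. -/
lemma Tcheck_eq (j : D.I) :
    D.Tcheck j = demazureLusztig (D.s j) (D.tA j) (D.dA j) (D.e (D.gradIdx j)) := by
  have he : (↑((D.isUnit_one_sub j).unit⁻¹) : D.A) = D.e (D.gradIdx j) := by
    refine D.eq_e ?_
    have h1 := (D.isUnit_one_sub j).val_inv_mul
    have h2 : algebraMap D.LP D.A (1 - D.x (-D.αP j)) = 1 - D.xA (-D.rootP (D.gradIdx j)) := by
      rw [map_sub, map_one]; rfl
    exact (congrArg _ h2.symm).trans h1
  have h1 : ∀ z : D.Smash, (D.τs j : D.𝕃) • z = D.ofARingHom (D.tA j) * z :=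
    fun z => D.smul_eq_ofA_mul _ z
  have h2 : ∀ z : D.Smash, ((D.τs j : D.𝕃) - (↑(D.τs j)⁻¹ : D.𝕃)) • z =
    D.ofARingHom (D.dA j) * z := fun z => D.smul_eq_ofA_mul _ z
  change _ = D.ofARingHom _ + _
  rw [Tcheck, he, single_eq, h1, h2, ← ofARingHom_apply, map_sub, map_mul, sub_mul, mul_sub,
    mul_sub, mul_one, ← mul_assoc]
  abel

/-! ### The braid relations in `𝒜 # W` -/

lemma altProd_zero {M : Type*} [Monoid M] (x y : M) : altProd x y 0 = 1 := rfl

section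
variable {D} {j k : D.I}

lemma root_reflectionPerm_gradIdx (j k : D.I) :
    D.R₀.root (D.R₀.reflectionPerm (D.gradIdx j) (D.gradIdx k)) =
      (-(D.affineCartan k j : ℝ)) • D.α j + (1 : ℝ) • D.α k := by
  rw [reflection_root]
  unfold α
  module

lemma root_reflectionPerm_of_eq {i : ι} {p q : ℝ}
    (hi : D.R₀.root i = p • D.α j + q • D.α k) :
    D.R₀.root (D.R₀.reflectionPerm (D.gradIdx j) i) =
      (-p - q * D.affineCartan k j) • D.α j + q • D.α k := by
  have h1 : ⟪D.α k, D.R₀.coroot (D.gradIdx j)⟫ = D.affineCartan k j := (D.cartan_cast _ _).symm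
  have h2 : ⟪D.α j, D.R₀.coroot (D.gradIdx j)⟫ = 2 := by
    refine (D.cartan_cast _ _).symm.trans ?_
    rw [cartan, RootPairing.pairingIn_same]; norm_num
  rw [RootPairing.root_reflectionPerm, reflection_eq, hi, inner_add_left, real_inner_smul_left,
    real_inner_smul_left, h1, h2]
  unfold α
  module

lemma s_smul_e' {i i' : ι} {p q : ℝ} (hi : D.R₀.root i = p • D.α j + q • D.α k)
    (hi' : D.R₀.root i' = p • D.α j + (-q - p * D.affineCartan j k) • D.α k) :
    D.s k • D.e i = D.e i' :=
  D.s_smul_e (p := q) (q := p) (k := j) (by rw [hi, add_comm]) (by rw [hi', add_comm])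

lemma root_left (j k : D.I) :
    D.R₀.root (D.gradIdx j) = (1 : ℝ) • D.α j + (0 : ℝ) • D.α k := by
  rw [one_smul, zero_smul, add_zero]; rfl

lemma root_right (j k : D.I) :
    D.R₀.root (D.gradIdx k) = (0 : ℝ) • D.α j + (1 : ℝ) • D.α k := by
  rw [one_smul, zero_smul, zero_add]; rfl

lemma Tcheck_braid_two (h1 : D.affineCartan j k = 0) (h2 : D.affineCartan k j = 0) :
    altProd (D.Tcheck j) (D.Tcheck k) 2 = altProd (D.Tcheck k) (D.Tcheck j) 2 := by
  have hjk : D.s j • D.e (D.gradIdx k) = D.e (D.gradIdx k) :=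
    D.s_smul_e (root_right j k) (by rw [h2, root_right j k]; simp)
  have hkj : D.s k • D.e (D.gradIdx j) = D.e (D.gradIdx j) :=
    D.s_smul_e (root_right k j) (by rw [h1, root_right k j]; simp)
  rw [Tcheck_eq, Tcheck_eq]
  exact demazureLusztig_braid_two (s_mul_comm_of_cartan h1 h2) (D.smul_tA _ _) (D.smul_dA _ _) hjk
    (D.smul_tA _ _) (D.smul_dA _ _) hkj

lemma Tcheck_braid_three (h1 : D.affineCartan j k = -1) (h2 : D.affineCartan k j = -1) :
    altProd (D.Tcheck j) (D.Tcheck k) 3 = altProd (D.Tcheck k) (D.Tcheck j) 3 := by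
  set i2 := D.R₀.reflectionPerm (D.gradIdx j) (D.gradIdx k) with hi2
  have r0 := root_left j k
  have r1 := root_right j k
  have r2 : D.R₀.root i2 = (1 : ℝ) • D.α j + (1 : ℝ) • D.α k := by
    rw [hi2, root_reflectionPerm_gradIdx, h2]; norm_num
  have hj1 : D.s j • D.e (D.gradIdx k) = D.e i2 := D.s_smul_e r1 (by rw [h2, r2]; norm_num)
  have hj2 : D.s j • D.e i2 = D.e (D.gradIdx k) := D.s_smul_e r2 (by rw [h2, r1]; norm_num)
  have hk0 : D.s k • D.e (D.gradIdx j) = D.e i2 := s_smul_e' r0 (by rw [h1, r2]; norm_num)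
  have hk2 : D.s k • D.e i2 = D.e (D.gradIdx j) := s_smul_e' r2 (by rw [h1, r0]; norm_num)
  -- Both s_j α_k and s_k α_j equal α_j + α_k, so the two roots lie in one W₀-orbit and share their
  -- parameter.
  have hτ : D.τs k = D.τs j := by
    have h3 : D.τs k = D.τ i2 :=
      D.τ_eq (Subgroup.subset_closure ⟨D.gradIdx j, rfl⟩) (D.R₀.root_reflectionPerm _ _).symm
    have h4 : D.τs j = D.τ i2 :=
      D.τ_eq (Subgroup.subset_closure ⟨D.gradIdx k, rfl⟩) (by
        rw [← D.R₀.root_reflectionPerm, root_reflectionPerm_gradIdx, h1, r2, add_comm]; norm_num)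
    exact h3.trans h4.symm
  have hd : D.dA k = D.dA j := by unfold dA; rw [hτ]
  have ht : D.tA k = D.tA j := by unfold tA; rw [hτ]
  rw [Tcheck_eq, Tcheck_eq, hd, ht]
  exact demazureLusztig_braid_three (s_braid_three h1 h2) (D.s_mul_self j) (D.s_mul_self k)
    (D.tA_mul_sub j) (D.smul_tA _ _) (D.smul_tA _ _) (D.smul_dA _ _) (D.smul_dA _ _)
    (D.s_smul_e_self j) hj1 hj2 hk0 (D.s_smul_e_self k) hk2
    (D.e_mul_e (by rw [r2, r0, r1]; module))

lemma Tcheck_braid_four (h1 : D.affineCartan j k = -1) (h2 : D.affineCartan k j = -2) :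
    altProd (D.Tcheck j) (D.Tcheck k) 4 = altProd (D.Tcheck k) (D.Tcheck j) 4 := by
  set i2 := D.R₀.reflectionPerm (D.gradIdx k) (D.gradIdx j) with hi2
  set i3 := D.R₀.reflectionPerm (D.gradIdx j) (D.gradIdx k) with hi3
  have r0 := root_left j k
  have r1 := root_right j k
  have r2 : D.R₀.root i2 = (1 : ℝ) • D.α j + (1 : ℝ) • D.α k := by
    rw [hi2, root_reflectionPerm_gradIdx, h1, add_comm]; norm_num
  have r3 : D.R₀.root i3 = (2 : ℝ) • D.α j + (1 : ℝ) • D.α k := by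
    rw [hi3, root_reflectionPerm_gradIdx, h2]; norm_num
  have hj1 : D.s j • D.e (D.gradIdx k) = D.e i3 := D.s_smul_e r1 (by rw [h2, r3]; norm_num)
  have hj2 : D.s j • D.e i2 = D.e i2 := D.s_smul_e r2 (by rw [h2, r2]; norm_num)
  have hj3 : D.s j • D.e i3 = D.e (D.gradIdx k) := D.s_smul_e r3 (by rw [h2, r1]; norm_num)
  have hk0 : D.s k • D.e (D.gradIdx j) = D.e i2 := s_smul_e' r0 (by rw [h1, r2]; norm_num)
  have hk2 : D.s k • D.e i2 = D.e (D.gradIdx j) := s_smul_e' r2 (by rw [h1, r0]; norm_num)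
  have hk3 : D.s k • D.e i3 = D.e i3 := s_smul_e' r3 (by rw [h1, r3]; norm_num)
  rw [Tcheck_eq, Tcheck_eq]
  exact demazureLusztig_braid_four (s_braid_four h1 h2) (D.s_mul_self j) (D.s_mul_self k)
    (D.tA_mul_sub j) (D.tA_mul_sub k) (D.smul_tA _ _) (D.smul_tA _ _) (D.smul_tA _ _)
    (D.smul_tA _ _) (D.smul_dA _ _) (D.smul_dA _ _) (D.smul_dA _ _) (D.smul_dA _ _)
    (D.s_smul_e_self j) hj1 hj2 hj3 hk0 (D.s_smul_e_self k) hk2 hk3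
    (D.e_mul_e (by rw [r2, r0, r1]; module)) (D.e_mul_e (by rw [r3, r0, r2]; module))

lemma Tcheck_braid_six (h1 : D.affineCartan j k = -1) (h2 : D.affineCartan k j = -3) :
    altProd (D.Tcheck j) (D.Tcheck k) 6 = altProd (D.Tcheck k) (D.Tcheck j) 6 := by
  set i2 := D.R₀.reflectionPerm (D.gradIdx k) (D.gradIdx j) with hi2
  set i3 := D.R₀.reflectionPerm (D.gradIdx j) i2 with hi3
  set i4 := D.R₀.reflectionPerm (D.gradIdx j) (D.gradIdx k) with hi4
  set i5 := D.R₀.reflectionPerm (D.gradIdx k) i4 with hi5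
  have r0 := root_left j k
  have r1 := root_right j k
  have r2 : D.R₀.root i2 = (1 : ℝ) • D.α j + (1 : ℝ) • D.α k := by
    rw [hi2, root_reflectionPerm_gradIdx, h1, add_comm]; norm_num
  have r3 : D.R₀.root i3 = (2 : ℝ) • D.α j + (1 : ℝ) • D.α k := by
    rw [hi3, root_reflectionPerm_of_eq r2, h2]; norm_num
  have r4 : D.R₀.root i4 = (3 : ℝ) • D.α j + (1 : ℝ) • D.α k := by
    rw [hi4, root_reflectionPerm_gradIdx, h2]; norm_num
  have r5 : D.R₀.root i5 = (3 : ℝ) • D.α j + (2 : ℝ) • D.α k := by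
    rw [hi5, root_reflectionPerm_of_eq (r4.trans (add_comm _ _)), h1, add_comm]; norm_num
  have hj1 : D.s j • D.e (D.gradIdx k) = D.e i4 := D.s_smul_e r1 (by rw [h2, r4]; norm_num)
  have hj2 : D.s j • D.e i2 = D.e i3 := D.s_smul_e r2 (by rw [h2, r3]; norm_num)
  have hj3 : D.s j • D.e i3 = D.e i2 := D.s_smul_e r3 (by rw [h2, r2]; norm_num)
  have hj4 : D.s j • D.e i4 = D.e (D.gradIdx k) := D.s_smul_e r4 (by rw [h2, r1]; norm_num)
  have hj5 : D.s j • D.e i5 = D.e i5 := D.s_smul_e r5 (by rw [h2, r5]; norm_num)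
  have hk0 : D.s k • D.e (D.gradIdx j) = D.e i2 := s_smul_e' r0 (by rw [h1, r2]; norm_num)
  have hk2 : D.s k • D.e i2 = D.e (D.gradIdx j) := s_smul_e' r2 (by rw [h1, r0]; norm_num)
  have hk3 : D.s k • D.e i3 = D.e i3 := s_smul_e' r3 (by rw [h1, r3]; norm_num)
  have hk4 : D.s k • D.e i4 = D.e i5 := s_smul_e' r4 (by rw [h1, r5]; norm_num)
  have hk5 : D.s k • D.e i5 = D.e i4 := s_smul_e' r5 (by rw [h1, r4]; norm_num)
  rw [Tcheck_eq, Tcheck_eq]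
  exact demazureLusztig_braid_six (s_braid_six h1 h2) (D.s_mul_self j) (D.s_mul_self k)
    (D.tA_mul_sub j) (D.tA_mul_sub k) (D.smul_tA _ _) (D.smul_tA _ _) (D.smul_tA _ _)
    (D.smul_tA _ _) (D.smul_dA _ _) (D.smul_dA _ _) (D.smul_dA _ _) (D.smul_dA _ _)
    (D.s_smul_e_self j) hj1 hj2 hj3 hj4 hj5 hk0 (D.s_smul_e_self k) hk2 hk3 hk4 hk5
    (D.e_mul_e (by rw [r2, r0, r1]; module)) (D.e_mul_e (by rw [r3, r0, r2]; module))
    (D.e_mul_e (by rw [r4, r0, r3]; module)) (D.e_mul_e (by rw [r5, r4, r1]; module))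
    (D.e_mul_e (by rw [r5, r2, r3]; module))

lemma Tcheck_braid (h : j ≠ k) : altProd (D.Tcheck j) (D.Tcheck k) (D.coxeterM j k) =
    altProd (D.Tcheck k) (D.Tcheck j) (D.coxeterM j k) := by
  rcases D.affineCartan_cases h with
    ⟨h1, h2⟩ | ⟨h1, h2⟩ | ⟨h1, h2⟩ | ⟨h1, h2⟩ | ⟨h1, h2⟩ | ⟨h1, h2⟩ | ⟨h1, h2⟩
  · rw [coxeterM_eq_two h1 h2]; exact Tcheck_braid_two h1 h2
  · rw [coxeterM_eq_three h1 h2]; exact Tcheck_braid_three h1 h2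
  · rw [coxeterM_eq_four h1 h2]; exact Tcheck_braid_four h1 h2
  · rw [coxeterM_comm, coxeterM_eq_four h2 h1]; exact (Tcheck_braid_four h2 h1).symm
  · rw [coxeterM_eq_six h1 h2]; exact Tcheck_braid_six h1 h2
  · rw [coxeterM_comm, coxeterM_eq_six h2 h1]; exact (Tcheck_braid_six h2 h1).symm
  · rw [coxeterM_eq_zero h1 h2, altProd_zero, altProd_zero]

end

/-! ### The basic representation -/

open SkewMonoidAlgebra (single)

lemma ofW_mul (w w' : D.W) : D.ofW w * D.ofW w' = D.ofW (w * w') := by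
  unfold ofW
  rw [SkewMonoidAlgebra.single_mul_single, smul_one, mul_one]

lemma ofW_mul_ofA (w : D.W) (f : D.A) :
    D.ofW w * D.ofARingHom f = D.ofARingHom (w • f) * D.ofW w :=
  single_mul_singleOneRingHom _ _ _

lemma ofW_mul_Tcheck {u : D.W} {j k : D.I} (h : actFn (u : V ≃ᵃ[ℝ] V) (D.a j) = D.a k) :
    D.ofW u * D.Tcheck j = D.Tcheck k * D.ofW u := by
  have hτ := D.τs_eq_of_actFn h
  have hd : D.dA j = D.dA k := by unfold dA; rw [hτ]
  have ht : D.tA j = D.tA k := by unfold tA; rw [hτ]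
  have he : u • D.e (D.gradIdx j) = D.e (D.gradIdx k) := D.smul_e (D.linear_α h)
  have h1 : u • (D.dA j * D.e (D.gradIdx j)) = D.dA k * D.e (D.gradIdx k) := by
    rw [smul_mul', smul_dA, he, hd]
  have h2 : u • (D.tA j - D.dA j * D.e (D.gradIdx j)) = D.tA k - D.dA k * D.e (D.gradIdx k) := by
    rw [smul_sub, h1, smul_tA, ht]
  have h3 : ∀ i, D.Tcheck i = D.ofARingHom (D.dA i * D.e (D.gradIdx i)) +
      D.ofARingHom (D.tA i - D.dA i * D.e (D.gradIdx i)) * D.ofW (D.s i) := fun i => by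
    rw [Tcheck_eq, ← single_eq]; rfl
  rw [h3, h3, mul_add, add_mul, ← mul_assoc, ofW_mul_ofA, ofW_mul_ofA, h1, h2, mul_assoc, mul_assoc,
    ofW_mul, ofW_mul, D.mul_s_of_actFn h]

lemma Tcheck_mul_xA (j : D.I) {l : D.P} {q : D.LP}
    (hq : q * (1 - D.x (-D.αP j)) = D.x l - D.x (D.lin (D.s j) l)) :
    D.Tcheck j * D.ofARingHom (D.xA l) =
      D.ofARingHom (D.xA (D.lin (D.s j) l)) * D.Tcheck j +
        D.ofARingHom (D.dA j * algebraMap D.LP D.A q) := by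
  rw [Tcheck_eq, ← D.e_mul_sub j hq, ← smul_xA]
  exact demazureLusztig_mul_singleOneRingHom _ _ _ _ _

lemma Tcheck_quadratic (j : D.I) :
    (D.Tcheck j - algebraMap D.𝕃 D.Smash (D.τs j : D.𝕃)) *
      (D.Tcheck j + algebraMap D.𝕃 D.Smash (↑(D.τs j)⁻¹ : D.𝕃)) = 0 := by
  rw [Tcheck_eq]
  refine demazureLusztig_quadratic (D.s_mul_self j) ?_ ?_ (D.smul_tA _ _) (D.smul_dA _ _)
    (D.s_smul_e_self j)
  · unfold tA dA; rw [← map_sub, sub_sub_cancel]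
  · unfold tA; rw [← map_mul, Units.mul_inv, map_one]

/-- The images of the generators of `ℋ` in `𝒜 # W`. -/
def genImage : D.Gen → D.Smash
  | .T j => D.Tcheck j
  | .U u => D.ofW u
  | .X l => D.ofARingHom (D.xA l)

/-- The basic representation on the free algebra. -/
def basicRepFree : D.Free →ₐ[D.𝕃] D.Smash := FreeAlgebra.lift D.𝕃 D.genImage

lemma basicRepFree_T (j : D.I) : D.basicRepFree (D.gT j) = D.Tcheck j :=
  FreeAlgebra.lift_ι_apply _ _

lemma basicRepFree_U (u : D.Ω) : D.basicRepFree (D.gU u) = D.ofW u :=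
  FreeAlgebra.lift_ι_apply _ _

lemma basicRepFree_X (l : D.P) : D.basicRepFree (D.gX l) = D.ofARingHom (D.xA l) :=
  FreeAlgebra.lift_ι_apply _ _

lemma map_altProd {M N F : Type*} [Monoid M] [Monoid N] [FunLike F M N] [MonoidHomClass F M N]
    (f : F) (x y : M) (m : ℕ) : f (altProd x y m) = altProd (f x) (f y) m := by
  induction m generalizing x y with
  | zero => exact map_one f
  | succ m ih => rw [altProd, altProd, map_mul, ih]

lemma sum_smul_xA (q : D.LP) :
    (q.coeff.sum fun l r => r • D.ofARingHom (D.xA l)) = D.ofARingHom (algebraMap D.LP D.A q) := by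
  have h1 : q = q.coeff.sum fun l r => r • D.x l := by
    conv_lhs => rw [← AddMonoidAlgebra.sum_coeff_single q]
    refine Finsupp.sum_congr fun l _ => ?_
    simp [x]
  conv_rhs => rw [h1]
  rw [Finsupp.sum, Finsupp.sum, map_sum, map_sum]
  refine Finset.sum_congr rfl fun l _ => ?_
  rw [smul_eq_ofA_mul, Algebra.smul_def, map_mul, map_mul, ← IsScalarTower.algebraMap_apply]
  rfl

lemma basicRepFree_rel {x y : D.Free} (h : D.Rel x y) : D.basicRepFree x = D.basicRepFree y := by
  cases h with
  | U_one => rw [basicRepFree_U, map_one]; rfl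
  | U_mul u u' => rw [map_mul, basicRepFree_U, basicRepFree_U, basicRepFree_U, ofW_mul]; rfl
  | U_T u j k h =>
    rw [map_mul, map_mul, basicRepFree_U, basicRepFree_T, basicRepFree_T, D.ofW_mul_Tcheck h]
  | quadratic j =>
    rw [map_mul, map_sub, map_add, AlgHom.commutes, AlgHom.commutes, basicRepFree_T, map_zero,
      Tcheck_quadratic]
  | braid j k h =>
    rw [map_altProd, map_altProd, basicRepFree_T, basicRepFree_T, Tcheck_braid h]
  | U_X u l =>
    rw [map_mul, map_mul, basicRepFree_U, basicRepFree_X, basicRepFree_X, ofW_mul_ofA, smul_xA]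
  | T_X j l q hq =>
    have h1 : D.basicRepFree (D.gXlin q) = D.ofARingHom (algebraMap D.LP D.A q) := by
      rw [← sum_smul_xA, gXlin, Finsupp.sum, Finsupp.sum, map_sum]
      refine Finset.sum_congr rfl fun l _ => ?_
      rw [map_smul, basicRepFree_X]
    rw [map_mul, map_add, map_mul, map_smul, h1, basicRepFree_T, basicRepFree_X, basicRepFree_X,
      D.Tcheck_mul_xA j hq, smul_eq_ofA_mul, ← map_mul]
    rfl
  | X_zero => rw [basicRepFree_X, xA_zero, map_one, map_one]
  | X_add l l' =>
    rw [map_mul, basicRepFree_X, basicRepFree_X, basicRepFree_X, xA_add, map_mul]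

/-- The basic representation `ℋ → 𝒜 # W`. -/
def basicRep : D.DAHA →ₐ[D.𝕃] D.Smash :=
  RingQuot.liftAlgHom D.𝕃 ⟨D.basicRepFree, fun _ _ h => D.basicRepFree_rel h⟩

lemma basicRep_mk (x : D.Free) :
    D.basicRep (RingQuot.mkAlgHom D.𝕃 D.Rel x) = D.basicRepFree x :=
  RingQuot.liftAlgHom_mkAlgHom_apply ..

lemma basicRep_T (j : D.I) : D.basicRep (D.T j) = D.Tcheck j :=
  (D.basicRep_mk _).trans (D.basicRepFree_T j)

lemma basicRep_U (u : D.Ω) : D.basicRep (D.U u) = D.ofW u :=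
  (D.basicRep_mk _).trans (D.basicRepFree_U u)

lemma basicRep_X (l : D.P) : D.basicRep (D.X l) = D.ofARingHom (D.xA l) :=
  (D.basicRep_mk _).trans (D.basicRepFree_X l)

variable {D} in
lemma algHom_ext {f g : D.DAHA →ₐ[D.𝕃] D.Smash} (hT : ∀ j, f (D.T j) = g (D.T j))
    (hU : ∀ u, f (D.U u) = g (D.U u)) (hX : ∀ l, f (D.X l) = g (D.X l)) : f = g := by
  refine RingQuot.ringQuot_ext' _ _ _ (FreeAlgebra.hom_ext (funext fun x => ?_))
  cases x with
  | T j => exact hT j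
  | U u => exact hU u
  | X l => exact hX l

/-! ### The basis of `ℋ` -/

lemma mk_rel {x y : D.Free} (h : D.Rel x y) :
    RingQuot.mkAlgHom D.𝕃 D.Rel x = RingQuot.mkAlgHom D.𝕃 D.Rel y := RingQuot.mkAlgHom_rel _ h

lemma U_one : D.U 1 = 1 := (D.mk_rel .U_one).trans (map_one _)

lemma U_mul (u u' : D.Ω) : D.U u * D.U u' = D.U (u * u') := by
  have := D.mk_rel (.U_mul u u')
  rwa [map_mul] at this

lemma U_mul_T {u : D.Ω} {j k : D.I} (h : actFn ((u : D.W) : V ≃ᵃ[ℝ] V) (D.a j) = D.a k) :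
    D.U u * D.T j = D.T k * D.U u := by
  have := D.mk_rel (.U_T u j k h)
  rwa [map_mul, map_mul] at this

lemma U_mul_X (u : D.Ω) (l : D.P) : D.U u * D.X l = D.X (D.lin u l) * D.U u := by
  have := D.mk_rel (.U_X u l)
  rwa [map_mul, map_mul] at this

lemma X_zero : D.X 0 = 1 := (D.mk_rel .X_zero).trans (map_one _)

lemma X_mul (l l' : D.P) : D.X l * D.X l' = D.X (l + l') := by
  have := D.mk_rel (.X_add l l')
  rwa [map_mul] at this

lemma T_braid {j k : D.I} (h : j ≠ k) :
    altProd (D.T j) (D.T k) (D.coxeterM j k) = altProd (D.T k) (D.T j) (D.coxeterM j k) := by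
  have := D.mk_rel (.braid j k h)
  rwa [map_altProd, map_altProd] at this

lemma T_mul_T (j : D.I) :
    D.T j * D.T j = ((D.τs j : D.𝕃) - (↑(D.τs j)⁻¹ : D.𝕃)) • D.T j + 1 := by
  have h0 : D.gT j * D.gT j = (D.gT j - algebraMap D.𝕃 D.Free (D.τs j : D.𝕃)) *
      (D.gT j + algebraMap D.𝕃 D.Free (↑(D.τs j)⁻¹ : D.𝕃)) +
        (((D.τs j : D.𝕃) - (↑(D.τs j)⁻¹ : D.𝕃)) • D.gT j + 1) := by
    rw [Algebra.smul_def, map_sub, sub_mul, sub_mul, mul_add, mul_add, ← map_mul, Units.mul_inv,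
      map_one, ← Algebra.commutes]
    abel
  have h1 := congrArg (RingQuot.mkAlgHom D.𝕃 D.Rel) h0
  rwa [map_add, D.mk_rel (.quadratic j), map_zero, zero_add, map_mul, map_add, map_smul,
    map_one] at h1

/-- The `𝕃`-linear map `𝕃[P] → ℋ`, `X^l ↦ X^l`. -/
def XLin : D.LP →ₗ[D.𝕃] D.DAHA :=
  (Finsupp.linearCombination D.𝕃 D.X).comp (AddMonoidAlgebra.coeffLinearEquiv D.𝕃).toLinearMap

lemma XLin_apply (q : D.LP) : D.XLin q = q.coeff.sum fun l r => r • D.X l := rfl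

lemma XLin_x (l : D.P) : D.XLin (D.x l) = D.X l := by
  rw [XLin_apply, x, AddMonoidAlgebra.coeff_single,
    Finsupp.sum_single_index (zero_smul D.𝕃 (D.X l)), one_smul]

lemma T_mul_X (j : D.I) (l : D.P) : ∃ q : D.LP,
    D.T j * D.X l = D.X (D.lin (D.s j) l) * D.T j +
      ((D.τs j : D.𝕃) - (↑(D.τs j)⁻¹ : D.𝕃)) • D.XLin q := by
  obtain ⟨q, hq⟩ := D.exists_quotient j l
  refine ⟨q, ?_⟩
  have h1 := D.mk_rel (.T_X j l q hq)
  rw [map_mul, map_add, map_mul, map_smul] at h1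
  have h2 : RingQuot.mkAlgHom D.𝕃 D.Rel (D.gXlin q) = D.XLin q := by
    rw [gXlin, XLin_apply, Finsupp.sum, Finsupp.sum, map_sum]
    exact Finset.sum_congr rfl fun l _ => map_smul _ _ _
  rw [h2] at h1
  exact h1

/-- `h` is a product `T_{j_1} ⋯ T_{j_r} T_u` for a reduced expression `w = s_{j_1} ⋯ s_{j_r} u`. -/
inductive IsReducedProd : D.W → D.DAHA → Prop
  | base (u : D.Ω) : IsReducedProd u (D.U u)
  | step {w : D.W} {h : D.DAHA} (j : D.I) (hj : D.a j ((w : V ≃ᵃ[ℝ] V) D.x₀) < 0)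
      (hw : IsReducedProd (D.s j * w) h) : IsReducedProd w (D.T j * h)

lemma forall_pos_or_exists_neg (w : D.W) :
    w ∈ D.Ω ∨ ∃ j, D.a j ((w : V ≃ᵃ[ℝ] V) D.x₀) < 0 := by
  by_cases h : ∃ j, D.a j ((w : V ≃ᵃ[ℝ] V) D.x₀) < 0
  · exact Or.inr h
  · push Not at h
    exact Or.inl (D.mem_Ω_of_forall_pos fun j =>
      lt_of_le_of_ne (h j) (D.ne_zero_W (D.a_mem j) w).symm)

/-- Induction along descents. -/
@[elab_as_elim]
lemma descent_induction {p : D.W → Prop} (hΩ : ∀ u : D.Ω, p u)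
    (hs : ∀ (w : D.W) (j : D.I), D.a j ((w : V ≃ᵃ[ℝ] V) D.x₀) < 0 → p (D.s j * w) → p w)
    (w : D.W) : p w := by
  induction hn : D.length w using Nat.strong_induction_on generalizing w with
  | _ n ih =>
    obtain h | ⟨j, hj⟩ := D.forall_pos_or_exists_neg w
    · exact hΩ ⟨w, h⟩
    · have := D.length_s_mul_of_neg hj
      exact hs w j hj (ih _ (by lia) _ rfl)

lemma exists_isReducedProd (w : D.W) : ∃ h, D.IsReducedProd w h := by
  induction w using D.descent_induction with
  | hΩ u => exact ⟨_, .base u⟩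
  | hs w j hj ih => exact ⟨_, .step j hj ih.choose_spec⟩

lemma s_altProd {j k : D.I} (h : j ≠ k) : altProd (D.s j) (D.s k) (D.coxeterM j k) =
    altProd (D.s k) (D.s j) (D.coxeterM j k) := by
  rcases D.affineCartan_cases h with
    ⟨h1, h2⟩ | ⟨h1, h2⟩ | ⟨h1, h2⟩ | ⟨h1, h2⟩ | ⟨h1, h2⟩ | ⟨h1, h2⟩ | ⟨h1, h2⟩
  · rw [coxeterM_eq_two h1 h2]; simpa only [altProd, mul_one] using s_mul_comm_of_cartan h1 h2
  · rw [coxeterM_eq_three h1 h2]; simpa only [altProd, mul_one] using s_braid_three h1 h2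
  · rw [coxeterM_eq_four h1 h2]; simpa only [altProd, mul_one] using s_braid_four h1 h2
  · rw [coxeterM_comm, coxeterM_eq_four h2 h1]
    simpa only [altProd, mul_one] using (s_braid_four h2 h1).symm
  · rw [coxeterM_eq_six h1 h2]; simpa only [altProd, mul_one] using s_braid_six h1 h2
  · rw [coxeterM_comm, coxeterM_eq_six h2 h1]
    simpa only [altProd, mul_one] using (s_braid_six h2 h1).symm
  · rw [coxeterM_eq_zero h1 h2, altProd_zero, altProd_zero]

variable {D} in
lemma AltDescents.isReducedProd {n : ℕ} {j k : D.I} {w : D.W} (h : D.AltDescents n j k w)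
    {g : D.DAHA} (hg : D.IsReducedProd ((altProd (D.s j) (D.s k) n)⁻¹ * w) g) :
    D.IsReducedProd w (altProd (D.T j) (D.T k) n * g) := by
  induction n generalizing j k w with
  | zero => simpa only [altProd, inv_one, one_mul] using hg
  | succ n ih =>
    rw [altProd, mul_inv_rev, inv_s, mul_assoc] at hg
    rw [altProd, mul_assoc]
    exact .step j h.1 (ih h.2 hg)

/-- Matsumoto's theorem by induction on length. If two products start with different descents j, k,
then both agree, by induction, with a product starting with the longest alternating word in T_j,
T_k, and the braid relation compares the two forms of that word. -/
lemma isReducedProd_unique {w : D.W} {h h' : D.DAHA} (hw : D.IsReducedProd w h)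
    (hw' : D.IsReducedProd w h') : h = h' := by
  induction hn : D.length w using Nat.strong_induction_on generalizing w h h' with
  | _ n ih =>
    subst hn
    have ihs : ∀ {j : D.I} {g g' : D.DAHA}, D.a j ((w : V ≃ᵃ[ℝ] V) D.x₀) < 0 →
        D.IsReducedProd (D.s j * w) g → D.IsReducedProd (D.s j * w) g' → g = g' :=
      fun hj hg hg' => ih _ (by have := D.length_s_mul_of_neg hj; lia) hg hg' rfl
    have hpos : ∀ {u : D.Ω} {j : D.I}, w = u → ¬ D.a j ((w : V ≃ᵃ[ℝ] V) D.x₀) < 0 := by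
      rintro u j rfl; exact (D.pos_of_mem_Ω u j).not_gt
    generalize hv : w = v at hw'
    cases hw with
    | base u =>
      cases hw' with
      | base u' => rw [Subtype.ext hv]
      | step k hk hw' => subst hv; exact absurd hk (hpos rfl)
    | @step _ h1 j hj hw =>
      cases hw' with
      | base u' => exact absurd hj (hpos hv)
      | @step _ h2 k hk hw' =>
        subst hv
        by_cases hjk : j = k
        · subst hjk
          rw [ihs hj hw hw']
        · obtain ⟨hm, hd⟩ := D.altDescents_coxeterM hjk hj hk
          obtain ⟨-, hd'⟩ := D.altDescents_coxeterM (Ne.symm hjk) hk hj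
          rw [coxeterM_comm] at hd'
          have hb := D.T_braid hjk
          have hs := D.s_altProd hjk
          -- A common tail: a reduced product for what is left of w after removing the longest
          -- element of the dihedral group.
          obtain ⟨g, hg⟩ := D.exists_isReducedProd
            ((altProd (D.s j) (D.s k) (D.coxeterM j k))⁻¹ * w)
          have hg' := hg
          rw [hs] at hg'
          obtain ⟨m, hm'⟩ : ∃ m, D.coxeterM j k = m + 1 := ⟨_, (Nat.sub_add_cancel hm).symm⟩
          rw [hm'] at hd hd' hb hg hg'
          rw [altProd, mul_inv_rev, inv_s, mul_assoc] at hg hg'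
          rw [altProd, altProd] at hb
          rw [ihs hj hw (hd.2.isReducedProd hg), ihs hk hw' (hd'.2.isReducedProd hg'), ← mul_assoc,
            ← mul_assoc, hb]

/-- The element `T_w` of `ℋ`, for `w ∈ W`. -/
def Tw (w : D.W) : D.DAHA := (D.exists_isReducedProd w).choose

lemma isReducedProd_Tw (w : D.W) : D.IsReducedProd w (D.Tw w) :=
  (D.exists_isReducedProd w).choose_spec

lemma Tw_Ω (u : D.Ω) : D.Tw u = D.U u := D.isReducedProd_unique (D.isReducedProd_Tw _) (.base u)

lemma Tw_of_neg {w : D.W} {j : D.I} (h : D.a j ((w : V ≃ᵃ[ℝ] V) D.x₀) < 0) :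
    D.Tw w = D.T j * D.Tw (D.s j * w) :=
  D.isReducedProd_unique (D.isReducedProd_Tw _) (.step j h (D.isReducedProd_Tw _))

lemma Tw_one : D.Tw 1 = 1 := (D.Tw_Ω 1).trans D.U_one

/-- If s_j shortens w, the quadratic relation applies to the leading factor T_j of T_w; otherwise
T_j T_w is itself T_{s_j w}, and r = 0. -/
lemma T_mul_Tw (j : D.I) (w : D.W) : ∃ r : D.𝕃, D.T j * D.Tw w = r • D.Tw w + D.Tw (D.s j * w) := by
  rcases lt_or_gt_of_ne (D.ne_zero_W (D.a_mem j) w) with h | h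
  · refine ⟨(D.τs j : D.𝕃) - (↑(D.τs j)⁻¹ : D.𝕃), ?_⟩
    rw [D.Tw_of_neg h, ← mul_assoc, T_mul_T, add_mul, smul_mul_assoc, one_mul]
  · refine ⟨0, ?_⟩
    have h1 : D.a j (((D.s j * w : D.W) : V ≃ᵃ[ℝ] V) D.x₀) < 0 := by
      rw [coe_mul_apply, a_s_self]; linarith
    rw [D.Tw_of_neg h1, s_mul_s_mul, zero_smul, zero_add]

lemma U_mul_Tw (u : D.Ω) (w : D.W) : D.U u * D.Tw w = D.Tw (u * w) := by
  induction w using D.descent_induction with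
  | hΩ u' => rw [Tw_Ω, U_mul, ← Tw_Ω]; rfl
  | hs w j hj ih =>
    obtain ⟨σ, hσ⟩ := u.2
    have h1 : D.a (σ j) (((u * w : D.W) : V ≃ᵃ[ℝ] V) D.x₀) < 0 := by
      rw [coe_mul_apply, D.a_apply_of_actFn (hσ j)]; exact hj
    rw [D.Tw_of_neg hj, D.Tw_of_neg h1, ← mul_assoc, D.U_mul_T (hσ j), mul_assoc, ih, ← mul_assoc,
      ← mul_assoc, D.mul_s_of_actFn (hσ j)]

/-- The `𝕃`-span of the elements `X^l T_w`. -/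
def basisSpan : Submodule D.𝕃 D.DAHA :=
  Submodule.span D.𝕃 (Set.range fun p : D.P × D.W => D.X p.1 * D.Tw p.2)

lemma X_mul_Tw_mem (l : D.P) (w : D.W) : D.X l * D.Tw w ∈ D.basisSpan :=
  Submodule.subset_span ⟨(l, w), rfl⟩

lemma XLin_mul_Tw_mem (q : D.LP) (w : D.W) : D.XLin q * D.Tw w ∈ D.basisSpan := by
  rw [XLin_apply, Finsupp.sum, Finset.sum_mul]
  refine Submodule.sum_mem _ fun l _ => ?_
  rw [smul_mul_assoc]
  exact Submodule.smul_mem _ _ (D.X_mul_Tw_mem _ _)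

lemma mul_mem_basisSpan_of_forall {g : D.DAHA}
    (hg : ∀ l w, g * (D.X l * D.Tw w) ∈ D.basisSpan) {h : D.DAHA} (hh : h ∈ D.basisSpan) :
    g * h ∈ D.basisSpan := by
  induction hh using Submodule.span_induction with
  | mem _ hx => obtain ⟨⟨l, w⟩, rfl⟩ := hx; exact hg l w
  | zero => rw [mul_zero]; exact zero_mem _
  | add x y _ _ hx hy => rw [mul_add]; exact add_mem hx hy
  | smul r x _ hx => rw [mul_smul_comm]; exact Submodule.smul_mem _ _ hx

/-- The span is a left ideal: the cross relations move T_j and T_u past X^l, and then these act on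
T_w. As it contains 1, it is everything. -/
lemma mul_mem_basisSpan (g : D.Free) {h : D.DAHA} (hh : h ∈ D.basisSpan) :
    RingQuot.mkAlgHom D.𝕃 D.Rel g * h ∈ D.basisSpan := by
  induction g using FreeAlgebra.induction generalizing h with
  | grade0 r =>
    rw [AlgHom.commutes, ← Algebra.smul_def]
    exact Submodule.smul_mem _ _ hh
  | grade1 x =>
    refine D.mul_mem_basisSpan_of_forall (fun l w => ?_) hh
    cases x with
    | T j =>
      change D.T j * _ ∈ _
      obtain ⟨q, hq⟩ := D.T_mul_X j l
      obtain ⟨r, hr⟩ := D.T_mul_Tw j w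
      rw [← mul_assoc, hq, add_mul, mul_assoc, hr, mul_add, mul_smul_comm, smul_mul_assoc]
      exact add_mem (add_mem (Submodule.smul_mem _ _ (D.X_mul_Tw_mem _ _)) (D.X_mul_Tw_mem _ _))
        (Submodule.smul_mem _ _ (D.XLin_mul_Tw_mem _ _))
    | U u =>
      change D.U u * _ ∈ _
      rw [← mul_assoc, U_mul_X, mul_assoc, U_mul_Tw]
      exact D.X_mul_Tw_mem _ _
    | X l' =>
      change D.X l' * _ ∈ _
      rw [← mul_assoc, X_mul]
      exact D.X_mul_Tw_mem _ _
  | mul x y hx hy => rw [map_mul, mul_assoc]; exact hx (hy hh)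
  | add x y hx hy => rw [map_add, add_mul]; exact add_mem (hx hh) (hy hh)

lemma mem_basisSpan (h : D.DAHA) : h ∈ D.basisSpan := by
  obtain ⟨g, rfl⟩ := RingQuot.mkAlgHom_surjective D.𝕃 D.Rel h
  have h1 := D.X_mul_Tw_mem 0 1
  rw [X_zero, Tw_one, mul_one] at h1
  simpa only [mul_one] using D.mul_mem_basisSpan g h1

/-- Every element of `ℋ` is a combination of the `T_w` with coefficients in `𝕃[P]`. -/
lemma exists_eq_sum (h : D.DAHA) : ∃ p : D.W →₀ D.LP, h = p.sum fun w f => D.XLin f * D.Tw w := by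
  have h1 := D.mem_basisSpan h
  induction h1 using Submodule.span_induction with
  | mem _ hx =>
    obtain ⟨⟨l, w⟩, rfl⟩ := hx
    refine ⟨Finsupp.single w (D.x l), ?_⟩
    rw [Finsupp.sum_single_index (by rw [map_zero, zero_mul]), XLin_x]
  | zero => exact ⟨0, by rw [Finsupp.sum_zero_index]⟩
  | add x y _ _ hx hy =>
    obtain ⟨p, rfl⟩ := hx
    obtain ⟨p', rfl⟩ := hy
    refine ⟨p + p', ?_⟩
    rw [Finsupp.sum_add_index' (fun _ => by rw [map_zero, zero_mul])
      (fun _ _ _ => by rw [map_add, add_mul])]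
  | smul r x _ hx =>
    obtain ⟨p, rfl⟩ := hx
    refine ⟨r • p, ?_⟩
    rw [Finsupp.sum_smul_index' (fun _ => by rw [map_zero, zero_mul]), Finsupp.smul_sum]
    simp only [map_smul, smul_mul_assoc]

/-! ### Injectivity -/

/-- P is a subgroup of a rational vector space; this property ensures that its group algebra over
the domain 𝕃 has no zero divisors. -/
instance : TwoUniqueSums D.P :=
  TwoUniqueSums.of_injective_addHom D.P.subtype.toAddHom Subtype.val_injective
    (have : Module ℚ V := Module.compHom V (algebraMap ℚ ℝ); inferInstance)

lemma rootP_ne_zero (i : ι) : D.rootP i ≠ 0 := fun h =>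
  D.R₀.ne_zero i (congrArg Subtype.val h)

lemma δ_ne_zero : D.δ ≠ 0 := by
  refine Finset.prod_ne_zero_iff.2 fun i _ h => ?_
  have h1 := congrArg (fun f : D.LP => f.coeff 0) (sub_eq_zero.1 h)
  rw [AddMonoidAlgebra.one_def, x] at h1
  simp [D.rootP_ne_zero i] at h1

lemma powers_δ_le : Submonoid.powers D.δ ≤ nonZeroDivisors D.LP :=
  powers_le_nonZeroDivisors_of_noZeroDivisors D.δ_ne_zero

instance : IsDomain D.A := IsLocalization.isDomain_localization D.powers_δ_le

lemma algebraMap_LP_injective : Function.Injective (algebraMap D.LP D.A) :=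
  IsLocalization.injective D.A D.powers_δ_le

/-- The coefficient of `s_j` in `Ť_j`. -/
def cA (j : D.I) : D.A := D.tA j - D.dA j * D.e (D.gradIdx j)

/-- Multiplication by 1 - X^{-α_j} turns c_j into τ_j⁻¹ - τ_j X^{-α_j}, whose constant coefficient
τ_j⁻¹ is nonzero. -/
lemma cA_ne_zero (j : D.I) : D.cA j ≠ 0 := by
  intro h
  have h1 : algebraMap D.LP D.A (algebraMap D.𝕃 D.LP (↑(D.τs j)⁻¹ : D.𝕃) -
      (D.τs j : D.𝕃) • D.x (-D.rootP (D.gradIdx j))) = 0 := by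
    have h2 := D.e_mul (D.gradIdx j)
    have h3 : algebraMap D.𝕃 D.A (↑(D.τs j)⁻¹ : D.𝕃) = D.tA j - D.dA j := by
      unfold tA dA; rw [← map_sub, sub_sub_cancel]
    rw [map_sub, ← IsScalarTower.algebraMap_apply, Algebra.smul_def, map_mul,
      ← IsScalarTower.algebraMap_apply, h3]
    change D.tA j - D.dA j - D.tA j * D.xA _ = 0
    unfold cA at h
    linear_combination (1 - D.xA (-D.rootP (D.gradIdx j))) * h + D.dA j * h2
  have h2 := D.algebraMap_LP_injective (h1.trans (map_zero _).symm)
  have h3 := congrArg (fun f : D.LP => f.coeff 0) h2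
  have h4 : -D.rootP (D.gradIdx j) ≠ 0 := neg_ne_zero.2 (D.rootP_ne_zero _)
  simp [x, h4] at h3

lemma Tcheck_eq' (j : D.I) :
    D.Tcheck j = single 1 (D.dA j * D.e (D.gradIdx j)) + single (D.s j) (D.cA j) :=
  D.Tcheck_eq j

lemma coeff_Tcheck_mul (j : D.I) (z : D.Smash) (w : D.W) :
    (D.Tcheck j * z).coeff w =
      D.dA j * D.e (D.gradIdx j) * z.coeff w + D.cA j * D.s j • z.coeff (D.s j * w) := by
  rw [Tcheck_eq', add_mul, SkewMonoidAlgebra.coeff_add, Finsupp.add_apply,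
    SkewMonoidAlgebra.coeff_single_one_mul, SkewMonoidAlgebra.coeff_single_mul, inv_s]

/-- Left multiplication by Ť_j puts c_j times the s_j-image of the old leading coefficient at w. All
factors are nonzero in a domain, and a simple reflection raises lengths by at most 1. -/
lemma coeff_basicRep_Tw (w : D.W) : (D.basicRep (D.Tw w)).coeff w ≠ 0 ∧
    ∀ v, (D.basicRep (D.Tw w)).coeff v ≠ 0 → v = w ∨ D.length v < D.length w := by
  induction w using D.descent_induction with
  | hΩ u =>
    rw [Tw_Ω, basicRep_U, ofW]
    refine ⟨?_, fun v hv => Or.inl ?_⟩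
    · rw [SkewMonoidAlgebra.coeff_single, Finsupp.single_eq_same]; exact one_ne_zero
    · by_contra hne
      rw [SkewMonoidAlgebra.coeff_single, Finsupp.single_eq_of_ne hne] at hv
      exact hv rfl
  | hs w j hj ih =>
    obtain ⟨ih1, ih2⟩ := ih
    have hl := D.length_s_mul_of_neg hj
    rw [D.Tw_of_neg hj, map_mul, basicRep_T]
    refine ⟨?_, fun v hv => ?_⟩
    -- The diagonal part of Ť_j contributes nothing at w, since w is longer than every element
    -- occurring in the image of T_{s_j w}.
    · have h0 : (D.basicRep (D.Tw (D.s j * w))).coeff w = 0 := by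
        by_contra hne
        rcases ih2 w hne with h | h
        · rw [← h] at hl; lia
        · lia
      rw [coeff_Tcheck_mul, h0, mul_zero, zero_add]
      refine mul_ne_zero (D.cA_ne_zero j) fun h => ih1 ?_
      rw [← smul_zero (D.s j)] at h
      exact MulAction.injective (D.s j) h
    · by_contra! hcon
      obtain ⟨hne, hlt⟩ := hcon
      refine hv ?_
      have h1 : (D.basicRep (D.Tw (D.s j * w))).coeff v = 0 := by
        by_contra hne'
        rcases ih2 v hne' with h | h
        · rw [h] at hlt; lia
        · lia
      have h2 : (D.basicRep (D.Tw (D.s j * w))).coeff (D.s j * v) = 0 := by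
        by_contra hne'
        rcases ih2 _ hne' with h | h
        · exact hne (mul_left_cancel h)
        · have := D.length_s_mul_le (D.s j * v) j
          rw [s_mul_s_mul] at this
          lia
      rw [coeff_Tcheck_mul, h1, h2, smul_zero, mul_zero, mul_zero, add_zero]

lemma basicRep_XLin (q : D.LP) : D.basicRep (D.XLin q) = single 1 (algebraMap D.LP D.A q) := by
  refine Eq.trans ?_ (D.sum_smul_xA q)
  rw [XLin_apply, Finsupp.sum, Finsupp.sum, map_sum]
  refine Finset.sum_congr rfl fun l _ => ?_
  rw [map_smul, basicRep_X]

lemma basicRep_injective : Function.Injective D.basicRep := by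
  refine (injective_iff_map_eq_zero _).2 fun h hh => ?_
  obtain ⟨p, rfl⟩ := D.exists_eq_sum h
  suffices hp : p = 0 by rw [hp, Finsupp.sum_zero_index]
  by_contra hp
  -- By triangularity, no other term of the sum can contribute at an element w of maximal length in
  -- the support.
  obtain ⟨w, hw, hmax⟩ := Finset.exists_max_image p.support D.length
    (Finsupp.support_nonempty_iff.2 hp)
  have h1 := congrArg (fun z : D.Smash => z.coeff w) hh
  have h2 : ∀ v ∈ p.support, v ≠ w →
      (D.basicRep (D.XLin (p v) * D.Tw v)).coeff w = 0 := fun v hv hne => by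
    rw [map_mul, basicRep_XLin, SkewMonoidAlgebra.coeff_single_one_mul]
    have h3 : (D.basicRep (D.Tw v)).coeff w = 0 := by
      by_contra hne'
      rcases (D.coeff_basicRep_Tw v).2 w hne' with h | h
      · exact hne h.symm
      · exact absurd (hmax v hv) (not_le.2 h)
    rw [h3, mul_zero]
  have h4 : (D.basicRep (p.sum fun w f => D.XLin f * D.Tw w)).coeff w =
      algebraMap D.LP D.A (p w) * (D.basicRep (D.Tw w)).coeff w := by
    rw [Finsupp.sum, map_sum, ← SkewMonoidAlgebra.coeffAddEquiv_apply, map_sum,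
      Finsupp.finsetSum_apply]
    refine (Finset.sum_eq_single w h2 (fun h => absurd hw h)).trans ?_
    rw [map_mul, basicRep_XLin, SkewMonoidAlgebra.coeff_single_one_mul]
  have h5 := h4.symm.trans h1
  refine mul_ne_zero (fun h => Finsupp.mem_support_iff.1 hw ?_) (D.coeff_basicRep_Tw w).1 h5
  exact D.algebraMap_LP_injective (h.trans (map_zero _).symm)

end AffineRootData
end CriticalDAHA
end

theorem theorem3p1 {ι V : Type*} [Fintype ι] [NormedAddCommGroup V] [InnerProductSpace ℝ V]
    (D : CriticalDAHA.AffineRootData ι V) :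
    (∃! f : D.DAHA →ₐ[D.𝕃] D.Smash,
      (∀ j : D.I, f (D.T j) = D.Tcheck j) ∧
      (∀ u : D.Ω, f (D.U u) = D.ofW u) ∧
      (∀ l : D.P, f (D.X l) = D.ofA (algebraMap D.LP D.A (D.x l)))) ∧
    (∀ f : D.DAHA →ₐ[D.𝕃] D.Smash,
      (∀ j : D.I, f (D.T j) = D.Tcheck j) →
      (∀ u : D.Ω, f (D.U u) = D.ofW u) →
      (∀ l : D.P, f (D.X l) = D.ofA (algebraMap D.LP D.A (D.x l))) →
      Function.Injective f) := by
  have h : ∀ f : D.DAHA →ₐ[D.𝕃] D.Smash, (∀ j : D.I, f (D.T j) = D.Tcheck j) →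
      (∀ u : D.Ω, f (D.U u) = D.ofW u) →
      (∀ l : D.P, f (D.X l) = D.ofA (algebraMap D.LP D.A (D.x l))) → f = D.basicRep :=
    fun f hT hU hX => CriticalDAHA.AffineRootData.algHom_ext
      (fun j => (hT j).trans (D.basicRep_T j).symm) (fun u => (hU u).trans (D.basicRep_U u).symm)
      (fun l => (hX l).trans (D.basicRep_X l).symm)
  refine ⟨⟨D.basicRep, ⟨D.basicRep_T, D.basicRep_U, D.basicRep_X⟩,
    fun f hf => h f hf.1 hf.2.1 hf.2.2⟩, fun f hT hU hX => ?_⟩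
  rw [h f hT hU hX]
  exact D.basicRep_injective
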